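/- For integers $3\le d<n$, let $\mathcal H_1(n,d)$ ("a block plus a path") be the class of graphs on the vertex set $[n]=\{1,\dots,n\}$ obtained as follows. Choose an integer $1\le i\le d-2$ and $d-1$ distinct vertices $v_0,\dots,v_{i-1},v_{i+2},\dots,v_d$ of $[n]$, and let $S$ be the set of the remaining $n-d+1$ vertices. The edges of the graph are those of the path $v_0v_1\cdots v_{i-1}$, those of the path $v_{i+2}\cdots v_d$, and those of a graph with vertex set $S\cup\{v_{i-1},v_{i+2}\}$ in which any two vertices are at distance at most $2$, except that $v_{i-1}$ and $v_{i+2}$ are at distance exactly $3$. Theorem. There is a constant $c_1>0$ such that, for $3\le d<n-c_1\log n$ and $n\to\infty$, almost all connected graphs on $[n]$ of diameter at least $d$ belong to $\mathcal H_1(n,d)$, and the number of graphs on $[n]$ of diameter exactly $d$ is $$(1+o(1))\,\frac{d-2}{2}\,n_{(d-1)}\,3^{\,n-d+1}\,2^{\binom{n-d+1}{2}},\qquad n_{(k)}:=n(n-1)\cdots(n-k+1).$$ Both statements hold uniformly in $d$: for every $\varepsilon>0$ there is an $N$ such that for all $n\ge N$ and all integers $d$ with $3\le d<n-c_1\log n$,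 at most a fraction $\varepsilon$ of the connected graphs on $[n]$ of diameter at least $d$ lie outside $\mathcal H_1(n,d)$, and the number of graphs on $[n]$ of diameter exactly $d$ differs from $\frac{d-2}{2}n_{(d-1)}3^{n-d+1}2^{\binom{n-d+1}{2}}$ by at most $\varepsilon$ times that quantity. -/

import Mathlib

/-- The class of graphs with vertex set `S ∪ {a, b}` in which any two vertices are at distance at
most `2`, except for `a` and `b`, whose distance is `3`. Distances are `ℕ∞`-valued, so that
vertices in different components are at infinite distance. -/
def blockClass {V : Type*} (S : Set V) (a b : V) : Set (SimpleGraph ↥(S ∪ {a, b})) :=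
  {H | H.edist ⟨a, Or.inr (Or.inl rfl)⟩ ⟨b, Or.inr (Or.inr rfl)⟩ = 3 ∧
    ∀ x y : ↥(S ∪ {a, b}), s((x : V), (y : V)) ≠ s(a, b) → H.edist x y ≤ 2}

/-- The indices `0, …, i - 1` and `i + 2, …, d` of the vertices of the two paths. -/
def pathIndices (d i : ℕ) : Set ℕ :=
  {j | j < i ∨ (i + 2 ≤ j ∧ j ≤ d)}

/-- The edges `v j — v (j + 1)` with `j` and `j + 1` both in `pathIndices d i`, that is, the
disjoint union of the paths `v 0, …, v (i - 1)` and `v (i + 2), …, v d` (when `v` is injective on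
`pathIndices d i`). -/
def twoPaths {V : Type*} (d i : ℕ) (v : ℕ → V) : SimpleGraph V :=
  SimpleGraph.fromRel fun x y =>
    ∃ j, j ∈ pathIndices d i ∧ j + 1 ∈ pathIndices d i ∧ x = v j ∧ y = v (j + 1)

/-- The class of "block plus a path" graphs on `n` labelled vertices. For some `1 ≤ i ≤ d - 2`, take
distinct vertices `v 0, …, v (i - 1)` (the set `A`) and `v (i + 2), …, v d` (the set `B`), let `S`
be the set of the remaining vertices (there are `n - d + 1` of them), put a path on `A`, a path on
`B`, and a graph from `blockClass S (v (i - 1)) (v (i + 2))`; there are no other edges. Only the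
values of `v` on `pathIndices d i` matter. -/
def blockPlusPath (n d : ℕ) : Set (SimpleGraph (Fin n)) :=
  {G | ∃ (i : ℕ) (v : ℕ → Fin n) (S : Set (Fin n)),
    1 ≤ i ∧ i + 2 ≤ d ∧ Set.InjOn v (pathIndices d i) ∧ S = (v '' pathIndices d i)ᶜ ∧
    ∃ H ∈ blockClass S (v (i - 1)) (v (i + 2)),
      G = twoPaths d i v ⊔ H.map (Function.Embedding.subtype _)}

/-- The graphs on `n` labelled vertices of diameter exactly `d`. The extended diameter of a
disconnected graph is `⊤`, so these are connected when `1 ≤ n`. -/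
def graphsOfDiam (n d : ℕ) : Set (SimpleGraph (Fin n)) :=
  {G | G.ediam = (d : ℕ∞)}

/-- The graphs on `n` labelled vertices of (finite) diameter at least `d`. -/
def graphsOfDiamAtLeast (n d : ℕ) : Set (SimpleGraph (Fin n)) :=
  {G | G.Connected ∧ (d : ℕ∞) ≤ G.ediam}

/-! The count is squeezed between two bounds that agree to first order. Put m = n - d + 1 and let T
be the claimed main term. At most (1 + o(1))T connected graphs have diameter at least d
(`ncard_graphsOfDiamAtLeast_le`), and at least (1 - o(1))T graphs lie in `blockPlusPath` and have
diameter exactly d (`le_card_pathBlockData`, `card_pathBlockData_le`). Since the second family is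
contained in the first, both assertions follow.

Upper bound. A graph of diameter at least d has an ordered pair (u, w) at distance d, in both
orders, which gives the factor 1/2. Exploring from u by breadth-first layers, each vertex of a new
layer has a nonempty neighbourhood in the previous layer and none in earlier ones. This gives a
recursion over layer sizes (`layerCount`), which becomes `layerWeight` after factorials and powers
of 2 are divided out. The target is `layerWeight_one_le`: the weight is about (d - 2)3^m. From a
singleton layer, the next layer has some size b. If b = 1, nothing is lost and one more step has
been taken. If b is at least B, of order log n, then almost all weight comes from putting all but
one of the vertices not needed for singleton layers into the following layer, with singletons
afterwards; the binomial theorem sums these cases to 3^m. Sizes 2 ≤ b < B are negligible. So each of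
the d - 2 positions of the wide pair of layers contributes about 3^m.

Lower bound. The factor 3^m is the number of colourings of the block S by "adjacent to the left
path", "adjacent to the right path" and "adjacent to neither"; 2^(m choose 2) counts the graphs on
S. A union bound shows that almost all such pairs are good: any two vertices have a common neighbour
and each vertex has neighbours of each colour. Good pairs give graphs of diameter d whose only pair
at distance d is formed by the two path ends. The graph and one end recover all the data, so each
graph arises at most twice. -/

open Finset

/-! ### Normalised layer weights and their general bounds -/

/-- The normalised number of ways to choose a layer of size `b`, see `layerWeight`. -/
noncomputable def layerCoeff (k b : ℕ) : ℝ :=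
  ((k + 1).choose b : ℝ) / (k + 1) * (1 / 2) ^ ((b - 1) * (k - b))

/-- The normalised number of ways to attach `t + 1` further layers to a layer of size `a`, when
the new layers have `k + t - 1` vertices in total, see `layerCount_mul_factorial`. -/
noncomputable def layerWeight : ℕ → ℕ → ℕ → ℝ
  | 0, k, a => k * (k - 1) * (1 / 2) ^ (k - 1) * (2 ^ a - 1) * 2 ^ (a * (k - 2))
  | t + 1, k, a => ∑ b ∈ Ico 1 k, layerCoeff k b * (2 ^ a - 1) ^ b * layerWeight t (k + 1 - b) b

theorem two_pow_sub_one_nonneg (a : ℕ) : (0 : ℝ) ≤ 2 ^ a - 1 :=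
  sub_nonneg.2 (one_le_pow₀ (by norm_num))

theorem layerCoeff_nonneg (k b : ℕ) : 0 ≤ layerCoeff k b := by
  unfold layerCoeff; positivity

theorem layerWeight_nonneg (t k a : ℕ) (hk : 1 ≤ k) : 0 ≤ layerWeight t k a := by
  induction t generalizing k a with
  | zero =>
    have h1 : (0 : ℝ) ≤ k - 1 := by
      have : (1 : ℝ) ≤ k := by exact_mod_cast hk
      linarith
    have := two_pow_sub_one_nonneg a
    unfold layerWeight; positivity
  | succ t ih =>
    unfold layerWeight
    refine sum_nonneg fun b hb => ?_
    have hb := mem_Ico.1 hb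
    have := two_pow_sub_one_nonneg a
    have := layerCoeff_nonneg k b
    have := ih (k + 1 - b) b (by omega)
    positivity

theorem layerCoeff_mul_two_pow {k b : ℕ} (hb : 1 ≤ b) (hbk : b ≤ k) :
    layerCoeff k b * 2 ^ (b * (k - b)) = ((k + 1).choose b : ℝ) / (k + 1) * 2 ^ (k - b) := by
  obtain ⟨c, rfl⟩ := Nat.exists_eq_add_of_le' hb
  obtain ⟨e, rfl⟩ := Nat.exists_eq_add_of_le hbk
  unfold layerCoeff
  have h1 : c + 1 + e - (c + 1) = e := by omega
  have h2 : (c + 1) * e = c * e + e := by ring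
  rw [h1, h2, pow_add, Nat.add_sub_cancel, mul_assoc, ← mul_assoc ((1 / 2 : ℝ) ^ _), ← mul_pow]
  norm_num

theorem choose_succ_div_mul (k b : ℕ) :
    ((k + 1).choose b : ℝ) / (k + 1) * (k + 1 - b : ℕ) = k.choose b := by
  have h := Nat.choose_mul_succ_eq k b
  have h' : (k.choose b : ℝ) * (k + 1) = (k + 1).choose b * (k + 1 - b : ℕ) := by
    exact_mod_cast h
  rw [div_mul_eq_mul_div, ← h']
  field_simp

theorem choose_succ_div_le {k b : ℕ} (hb : 1 ≤ b) :
    ((k + 1).choose b : ℝ) / (k + 1) ≤ (k + 1) ^ (b - 1) := by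
  obtain ⟨c, rfl⟩ := Nat.exists_eq_add_of_le' hb
  rw [div_le_iff₀ (by positivity), Nat.add_sub_cancel, ← pow_succ]
  exact_mod_cast Nat.choose_le_pow (k + 1) (c + 1)

/-- For k = 2 there are as many vertices as layers, so all new layers are singletons and the only
freedom besides the labelling is the nonempty neighbourhood of the first one. -/
theorem layerWeight_two (t a : ℕ) : layerWeight t 2 a = 2 ^ a - 1 := by
  induction t generalizing a with
  | zero => norm_num [layerWeight]
  | succ t ih =>
    unfold layerWeight
    have : Ico 1 2 = {1} := rfl
    rw [this, sum_singleton, ih]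
    norm_num [layerCoeff]

theorem mul_pred_le_two_pow (k : ℕ) : k * (k - 1) ≤ 2 ^ k := by
  induction k with
  | zero => simp
  | succ k ih =>
    rcases le_or_gt k 3 with h | h
    · interval_cases k <;> simp
    · obtain ⟨j, rfl⟩ := Nat.exists_eq_add_of_le h
      rw [pow_succ]
      simp only [Nat.add_sub_cancel] at *
      have : 3 + 1 + j - 1 = 3 + j := by omega
      simp only [Nat.succ_eq_add_one, this] at ih ⊢
      nlinarith

theorem layerWeight_zero_le {k a : ℕ} (hk : 2 ≤ k) :
    layerWeight 0 k a ≤ k * (k - 1) * (1 / 2) ^ (k - 1) * 2 ^ (a * (k - 1)) := by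
  obtain ⟨j, rfl⟩ := Nat.exists_eq_add_of_le' hk
  have h2 : j + 2 - 2 = j := by omega
  have h1 : j + 2 - 1 = j + 1 := by omega
  have h3 : a * (j + 1) = a + a * j := by ring
  have h4 : (0 : ℝ) ≤ ((j + 2 : ℕ) : ℝ) - 1 := by push_cast; linarith [Nat.cast_nonneg (α := ℝ) j]
  unfold layerWeight
  have h5 := two_pow_sub_one_nonneg a
  rw [h2, h1, h3, pow_add (2 : ℝ) a, ← mul_assoc _ ((2 : ℝ) ^ a)]
  gcongr
  linarith

theorem layerWeight_zero_le_two_mul {k a : ℕ} (hk : 2 ≤ k) :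
    layerWeight 0 k a ≤ 2 * 2 ^ (a * (k - 1)) := by
  refine (layerWeight_zero_le hk).trans ?_
  gcongr
  have h := mul_pred_le_two_pow k
  obtain ⟨j, rfl⟩ := Nat.exists_eq_add_of_le' hk
  have h1 : j + 2 - 1 = j + 1 := by omega
  rw [h1] at h ⊢
  have h' : ((j + 2 : ℕ) : ℝ) * ((j + 2 : ℕ) - 1) ≤ 2 ^ (j + 2) := by
    have : (((j + 2) * (j + 1) : ℕ) : ℝ) ≤ ((2 ^ (j + 2) : ℕ) : ℝ) := by exact_mod_cast h
    push_cast at this ⊢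
    linarith
  calc _ ≤ (2 : ℝ) ^ (j + 2) * (1 / 2) ^ (j + 1) := by gcongr
    _ = 2 * (2 * (1 / 2)) ^ (j + 1) := by rw [mul_pow]; ring
    _ = 2 := by norm_num

/-- Polynomial loss per vertex in excess of one per layer. `Y` is a separate parameter so that the
induction hypothesis can be used for smaller k with the same `Y`. -/
theorem layerWeight_le_crude {Y : ℝ} {t k a : ℕ} (hk : 2 ≤ k) (hY : 2 * ((k : ℝ) + 1) ^ 2 ≤ Y) :
    layerWeight t k a ≤ ((t + 1) * Y) ^ (k - 2) * 2 ^ (a * (k - 1)) := by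
  rcases hk.eq_or_lt with rfl | hk3
  · rw [layerWeight_two]; simp
  have hk3R : (3 : ℝ) ≤ k := by exact_mod_cast hk3
  have hY2 : 2 ≤ Y := by nlinarith
  induction t generalizing k a with
  | zero =>
    refine (layerWeight_zero_le_two_mul hk).trans ?_
    gcongr
    have : Y ^ 1 ≤ Y ^ (k - 2) := pow_le_pow_right₀ (by linarith) (by omega)
    simp only [Nat.cast_zero, zero_add, one_mul]
    linarith
  | succ t ih =>
    rcases Nat.eq_zero_or_pos a with rfl | ha
    · unfold layerWeight
      rw [sum_eq_zero]
      · positivity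
      · intro b hb
        have hb := mem_Ico.1 hb
        rw [pow_zero, sub_self, zero_pow (by omega)]; ring
    set P : ℝ := (t + 1) * Y with hP
    have ht : (1 : ℝ) ≤ t + 1 := by linarith [Nat.cast_nonneg (α := ℝ) t]
    have hPY : Y ≤ P := by nlinarith
    have hkP : (k : ℝ) + 1 ≤ P := by nlinarith
    have hih : ∀ b ∈ Ico 1 k, layerWeight t (k + 1 - b) b ≤ P ^ (k - 1 - b) * 2 ^ (b * (k - b)) := by
      intro b hb
      have hb := mem_Ico.1 hb
      have hc : ((k + 1 - b : ℕ) : ℝ) ≤ k := by exact_mod_cast (by omega : k + 1 - b ≤ k)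
      have e1 : k + 1 - b - 2 = k - 1 - b := by omega
      have e2 : k + 1 - b - 1 = k - b := by omega
      rcases (show 2 ≤ k + 1 - b by omega).eq_or_lt with h2 | h2
      · rw [← h2, layerWeight_two]
        have : k - b = 1 := by omega
        have : k - 1 - b = 0 := by omega
        simp [*]
      · have := ih (k := k + 1 - b) (a := b) (by omega) (le_trans (by gcongr) hY) h2
          (by exact_mod_cast h2)
        rwa [e1, e2] at this
    have hterm : ∀ b ∈ Ico 1 k, layerCoeff k b * (2 ^ a - 1) ^ b * layerWeight t (k + 1 - b) b ≤
        ((k + 1).choose b : ℝ) / (k + 1) * ((2 ^ a - 1) ^ b * 2 ^ (k - b)) * P ^ (k - 1 - b) := by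
      intro b hb
      have hb' := mem_Ico.1 hb
      have := layerCoeff_nonneg k b
      have := two_pow_sub_one_nonneg a
      calc _ ≤ layerCoeff k b * (2 ^ a - 1) ^ b * (P ^ (k - 1 - b) * 2 ^ (b * (k - b))) := by
            gcongr; exact hih b hb
        _ = (layerCoeff k b * 2 ^ (b * (k - b))) * (2 ^ a - 1) ^ b * P ^ (k - 1 - b) := by ring
        _ = _ := by rw [layerCoeff_mul_two_pow hb'.1 hb'.2.le]; ring
    -- The term b = 1 keeps the full power P^(k-2); each b ≥ 2 loses at least one factor P, up to a
    -- factor k + 1, so all of them together fit into Y * P^(k-3).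
    have hsum : layerWeight (t + 1) k a ≤ P ^ (k - 2) * 2 ^ (a * (k - 1)) +
        ∑ b ∈ Ico 2 k, 2 * 2 ^ (a * (k - 1)) * ((k + 1) * P ^ (k - 3)) := by
      rw [layerWeight, sum_eq_sum_Ico_succ_bot (by omega)]
      refine add_le_add ((hterm 1 (mem_Ico.2 ⟨le_rfl, by omega⟩)).trans ?_)
        (sum_le_sum fun b hb => ?_)
      · have e : k - 1 - 1 = k - 2 := by omega
        have : ((k + 1).choose 1 : ℝ) / (k + 1) = 1 := by
          rw [Nat.choose_one_right]; push_cast; field_simp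
        rw [e, this, one_mul, mul_comm, pow_one]
        gcongr
        rcases (show 1 ≤ a from ha).eq_or_lt with rfl | ha2
        · norm_num
        · calc ((2 : ℝ) ^ a - 1) * 2 ^ (k - 1) ≤ 2 ^ a * 2 ^ (k - 1) := by gcongr; linarith
            _ = 2 ^ (a + (k - 1)) := by rw [pow_add]
            _ ≤ 2 ^ (a * (k - 1)) := by
              refine pow_le_pow_right₀ (by norm_num) ?_
              obtain ⟨j, hj⟩ := Nat.exists_eq_add_of_le (show 2 ≤ k - 1 by omega)
              obtain ⟨c, rfl⟩ := Nat.exists_eq_add_of_le (show 2 ≤ a from ha2)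
              rw [hj]; nlinarith [Nat.zero_le (c * j)]
      · have hb' := mem_Ico.1 hb
        refine (hterm b (mem_Ico.2 ⟨by omega, hb'.2⟩)).trans ?_
        have h1 : ((k + 1).choose b : ℝ) / (k + 1) * P ^ (k - 1 - b) ≤ (k + 1) * P ^ (k - 3) := by
          calc _ ≤ ((k : ℝ) + 1) ^ (b - 1) * P ^ (k - 1 - b) := by
                gcongr; exact choose_succ_div_le (by omega)
            _ = ((k : ℝ) + 1) * (k + 1) ^ (b - 2) * P ^ (k - 1 - b) := by
                rw [← pow_succ', show b - 2 + 1 = b - 1 by omega]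
            _ ≤ (k + 1) * P ^ (b - 2) * P ^ (k - 1 - b) := by gcongr
            _ = _ := by rw [mul_assoc, ← pow_add]; congr 2; omega
        have h2 : ((2 : ℝ) ^ a - 1) ^ b * 2 ^ (k - b) ≤ 2 * 2 ^ (a * (k - 1)) := by
          have := two_pow_sub_one_nonneg a
          calc _ ≤ ((2 : ℝ) ^ a) ^ b * 2 ^ (k - b) := by gcongr; linarith
            _ = 2 ^ (a * b + (k - b)) := by rw [← pow_mul, pow_add]
            _ ≤ 2 ^ (1 + a * (k - 1)) := by
              refine pow_le_pow_right₀ (by norm_num) ?_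
              obtain ⟨c, hc⟩ := Nat.exists_eq_add_of_le (show b ≤ k - 1 by omega)
              have : k - b = c + 1 := by omega
              rw [hc, this]; nlinarith
            _ = _ := by rw [pow_add, pow_one]
        have := two_pow_sub_one_nonneg a
        calc _ = (((2 : ℝ) ^ a - 1) ^ b * 2 ^ (k - b)) *
              (((k + 1).choose b : ℝ) / (k + 1) * P ^ (k - 1 - b)) := by ring
          _ ≤ _ := by gcongr
    refine hsum.trans ?_
    rw [sum_const, Nat.card_Ico, nsmul_eq_mul]
    have hk2 : ((k - 2 : ℕ) : ℝ) ≤ k := by exact_mod_cast Nat.sub_le k 2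
    -- Passing from t to t + 1 replaces P by P + Y, and P^(k-3) * (P + Y) ≤ (P + Y)^(k-2).
    have hmain : P ^ (k - 2) + (2 * (k + 1) ^ 2) * P ^ (k - 3) ≤
        (((t + 1 : ℕ) + 1 : ℝ) * Y) ^ (k - 2) := by
      have e : k - 2 = (k - 3) + 1 := by omega
      have hle : P ≤ ((t + 1 : ℕ) + 1 : ℝ) * Y := by push_cast; nlinarith
      calc P ^ (k - 2) + (2 * (k + 1) ^ 2) * P ^ (k - 3) ≤ P ^ (k - 2) + Y * P ^ (k - 3) := by
            gcongr
        _ = P ^ (k - 3) * (P + Y) := by rw [e, pow_succ]; ring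
        _ = P ^ (k - 3) * (((t + 1 : ℕ) + 1 : ℝ) * Y) := by rw [hP]; push_cast; ring
        _ ≤ (((t + 1 : ℕ) + 1 : ℝ) * Y) ^ (k - 3) * (((t + 1 : ℕ) + 1 : ℝ) * Y) := by gcongr
        _ = _ := by rw [e, pow_succ]
    calc _ ≤ P ^ (k - 2) * 2 ^ (a * (k - 1)) +
          k * (2 * 2 ^ (a * (k - 1)) * ((k + 1) * P ^ (k - 3))) := by gcongr
      _ = (P ^ (k - 2) + 2 * (k * (k + 1)) * P ^ (k - 3)) * 2 ^ (a * (k - 1)) := by ring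
      _ ≤ (P ^ (k - 2) + (2 * (k + 1) ^ 2) * P ^ (k - 3)) * 2 ^ (a * (k - 1)) := by
        have : (k : ℝ) * (k + 1) ≤ (k + 1) ^ 2 := by nlinarith
        gcongr
      _ ≤ _ := by gcongr

theorem layerCoeff_mul {k b : ℕ} (hb : 1 ≤ b) (hbk : b ≤ k) :
    layerCoeff k b * ((k + 1 - b : ℕ) * 2 ^ (b * (k - b))) = k.choose b * 2 ^ (k - b) := by
  rw [← choose_succ_div_mul, mul_left_comm, layerCoeff_mul_two_pow hb hbk]
  ring

theorem layerWeight_le_pow {n t k a : ℕ} (hk : 2 ≤ k) (hkn : k + 1 ≤ n) (ht : t + 1 ≤ n) :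
    layerWeight t k a ≤ (n : ℝ) ^ (4 * (k - 2)) * 2 ^ (a * (k - 1)) := by
  refine (layerWeight_le_crude hk le_rfl).trans ?_
  have h1 : (k : ℝ) + 1 ≤ n := by exact_mod_cast hkn
  have h2 : (t : ℝ) + 1 ≤ n := by exact_mod_cast ht
  have h3 : (2 : ℝ) ≤ n := by exact_mod_cast (by omega : 2 ≤ n)
  have h4 : ((t : ℝ) + 1) * (2 * (k + 1) ^ 2) ≤ (n : ℝ) ^ 4 := by
    calc ((t : ℝ) + 1) * (2 * (k + 1) ^ 2) ≤ (n : ℝ) * (n * n ^ 2) := by gcongr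
      _ = (n : ℝ) ^ 4 := by ring
  rw [pow_mul (n : ℝ)]
  gcongr

/-- After a wide layer the dominant choice is b = k - 1, which leaves only singletons. Every further
vertex withheld from that layer costs a factor 2^a ≥ n^8, more than the crude bound and the binomial
coefficient can win back. -/
theorem layerWeight_le_of_large {n t k a : ℕ} (hk : 2 ≤ k) (hkn : k + 1 ≤ n) (ht : t ≤ n)
    (ha : n ^ 8 ≤ 2 ^ a) : layerWeight t k a ≤ (1 + 4 / n) * (k * 2 ^ (a * (k - 1))) := by
  have hn2 : (2 : ℝ) ≤ n := by exact_mod_cast (by omega : 2 ≤ n)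
  have hkn' : (k : ℝ) + 1 ≤ n := by exact_mod_cast hkn
  have ha' : (n : ℝ) ^ 8 ≤ 2 ^ a := by exact_mod_cast ha
  cases t with
  | zero =>
    refine (layerWeight_zero_le hk).trans ?_
    have h1 : ((k : ℝ) - 1) * (1 / 2) ^ (k - 1) ≤ 1 := by
      have : k - 1 < 2 ^ (k - 1) := Nat.lt_two_pow_self
      have : ((k - 1 : ℕ) : ℝ) ≤ 2 ^ (k - 1) := by exact_mod_cast this.le
      rw [Nat.cast_sub (by omega), Nat.cast_one] at this
      rw [one_div, inv_pow, mul_inv_le_iff₀ (by positivity)]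
      linarith
    calc (k : ℝ) * (k - 1) * (1 / 2) ^ (k - 1) * 2 ^ (a * (k - 1)) =
          (((k : ℝ) - 1) * (1 / 2) ^ (k - 1)) * (k * 2 ^ (a * (k - 1))) := by ring
      _ ≤ (1 + 4 / n) * (k * 2 ^ (a * (k - 1))) := by
        gcongr
        have : (0 : ℝ) ≤ 4 / n := by positivity
        linarith
  | succ t =>
    have hpos := two_pow_sub_one_nonneg a
    have hbig : ∀ b ∈ Ico 1 (k - 1), layerCoeff k b * (2 ^ a - 1) ^ b *
        layerWeight t (k + 1 - b) b ≤ 4 / n ^ 2 * 2 ^ (a * (k - 1)) := by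
      intro b hb
      have hb := mem_Ico.1 hb
      obtain ⟨i, hi⟩ := Nat.exists_eq_add_of_le (show b + 2 ≤ k by omega)
      have hw := layerWeight_le_pow (n := n) (t := t) (k := k + 1 - b) (a := b) (by omega)
        (by omega) ht
      rw [show k + 1 - b - 2 = i + 1 by omega, show k + 1 - b - 1 = k - b by omega] at hw
      have hc := layerCoeff_nonneg k b
      have hch : ((k + 1).choose b : ℝ) / (k + 1) ≤ (n : ℝ) ^ (i + 2) := by
        rw [← Nat.choose_symm (by omega : b ≤ k + 1), show k + 1 - b = i + 3 by omega]
        refine (choose_succ_div_le (by omega)).trans ?_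
        rw [show i + 3 - 1 = i + 2 by omega]
        gcongr
      -- Here i + 1 = k - 1 - b is the number of withheld vertices; the gain is at most of order
      -- n^(6i+8), while the loss is at least n^(8(i+1)).
      have hpow : (n : ℝ) ^ (i + 2) * 2 ^ (i + 2) * n ^ (4 * (i + 1)) ≤
          4 / n ^ 2 * (2 ^ a) ^ (i + 1) := by
        rw [div_mul_eq_mul_div, le_div_iff₀ (by positivity)]
        calc (n : ℝ) ^ (i + 2) * 2 ^ (i + 2) * n ^ (4 * (i + 1)) * n ^ 2
            = 4 * (n ^ (5 * i + 8) * 2 ^ i) := by ring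
          _ ≤ 4 * (n ^ (5 * i + 8) * n ^ i) := by gcongr
          _ = 4 * n ^ (6 * i + 8) := by ring
          _ ≤ 4 * n ^ (8 * (i + 1)) := by
            gcongr
            · linarith
            · omega
          _ ≤ 4 * (2 ^ a) ^ (i + 1) := by rw [pow_mul]; gcongr
      calc _ ≤ layerCoeff k b * (2 ^ a) ^ b * ((n : ℝ) ^ (4 * (i + 1)) * 2 ^ (b * (k - b))) := by
            have := layerWeight_nonneg t (k + 1 - b) b (by omega)
            gcongr
            linarith
        _ = (layerCoeff k b * 2 ^ (b * (k - b))) * (2 ^ a) ^ b * n ^ (4 * (i + 1)) := by ring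
        _ = ((k + 1).choose b / (k + 1)) * 2 ^ (i + 2) * n ^ (4 * (i + 1)) * (2 ^ a) ^ b := by
            rw [layerCoeff_mul_two_pow hb.1 (by omega), show k - b = i + 2 by omega]; ring
        _ ≤ (n : ℝ) ^ (i + 2) * 2 ^ (i + 2) * n ^ (4 * (i + 1)) * (2 ^ a) ^ b := by gcongr
        _ ≤ 4 / n ^ 2 * (2 ^ a) ^ (i + 1) * (2 ^ a) ^ b := by gcongr
        _ = 4 / n ^ 2 * 2 ^ (a * (k - 1)) := by
            rw [show k - 1 = i + 1 + b by omega, pow_mul, pow_add _ (i + 1) b]; ring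
    have hlast : layerCoeff k (k - 1) * (2 ^ a - 1) ^ (k - 1) *
        layerWeight t (k + 1 - (k - 1)) (k - 1) ≤ k * 2 ^ (a * (k - 1)) := by
      have h := layerCoeff_mul (k := k) (b := k - 1) (by omega) (by omega)
      rw [show k + 1 - (k - 1) = 2 by omega, show k - (k - 1) = 1 by omega,
        Nat.choose_symm_of_eq_add (show k = k - 1 + 1 by omega), Nat.choose_one_right] at h
      have h' : layerCoeff k (k - 1) * 2 ^ (k - 1) = k := by
        rw [mul_one, pow_one] at h
        push_cast at h
        linarith
      have hc := layerCoeff_nonneg k (k - 1)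
      rw [show k + 1 - (k - 1) = 2 by omega, layerWeight_two]
      calc _ ≤ layerCoeff k (k - 1) * (2 ^ a) ^ (k - 1) * 2 ^ (k - 1) := by
            have := two_pow_sub_one_nonneg (k - 1)
            gcongr
            · linarith
            · linarith
        _ = (layerCoeff k (k - 1) * 2 ^ (k - 1)) * (2 ^ a) ^ (k - 1) := by ring
        _ = _ := by rw [h', ← pow_mul]
    rw [layerWeight, ← sum_Ico_consecutive _ (show 1 ≤ k - 1 by omega) (show k - 1 ≤ k by omega)]
    have hsing : Ico (k - 1) k = {k - 1} := by
      ext x; simp only [mem_Ico, mem_singleton]; omega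
    rw [hsing, sum_singleton]
    refine (add_le_add (sum_le_card_nsmul _ _ _ hbig) hlast).trans ?_
    rw [Nat.card_Ico, nsmul_eq_mul]
    have hc : ((k - 1 - 1 : ℕ) : ℝ) ≤ k := by exact_mod_cast (by omega : k - 1 - 1 ≤ k)
    calc _ ≤ (k : ℝ) * (4 / n ^ 2 * 2 ^ (a * (k - 1))) + k * 2 ^ (a * (k - 1)) := by gcongr
      _ = (1 + 4 / n ^ 2) * (k * 2 ^ (a * (k - 1))) := by ring
      _ ≤ _ := by
        gcongr
        exact le_self_pow₀ (by linarith) (by norm_num)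

/-- With the next layer also wide, the summand becomes a term of the binomial expansion of ((2^a -
1) + 2)^k: a vertex joins the first wide layer, or it joins the second and may or may not be
adjacent to the singleton that follows. For a = 1 this is the source of 3^k. -/
theorem sum_large_layerWeight_le {n t k B : ℕ} (hkn : k + 1 ≤ n) (ht : t ≤ n)
    (hB : n ^ 8 ≤ 2 ^ B) (a : ℕ) :
    ∑ b ∈ Ico 1 k with ¬ b < B, layerCoeff k b * (2 ^ a - 1) ^ b * layerWeight t (k + 1 - b) b ≤
      (1 + 4 / n) * (2 ^ a + 1) ^ k := by
  have hpos := two_pow_sub_one_nonneg a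
  calc _ ≤ ∑ b ∈ Ico 1 k with ¬ b < B,
        (1 + 4 / (n : ℝ)) * ((2 ^ a - 1) ^ b * 2 ^ (k - b) * k.choose b) := by
        refine sum_le_sum fun b hb => ?_
        obtain ⟨hb, hbB⟩ := mem_filter.1 hb
        have hb := mem_Ico.1 hb
        have hw := layerWeight_le_of_large (n := n) (t := t) (k := k + 1 - b) (a := b) (by omega)
          (by omega) ht (hB.trans (Nat.pow_le_pow_right (by norm_num) (by omega)))
        have hc := layerCoeff_nonneg k b
        calc _ ≤ layerCoeff k b * (2 ^ a - 1) ^ b *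
              ((1 + 4 / n) * ((k + 1 - b : ℕ) * 2 ^ (b * (k + 1 - b - 1)))) := by gcongr
          _ = (1 + 4 / n) * (2 ^ a - 1) ^ b *
              (layerCoeff k b * ((k + 1 - b : ℕ) * 2 ^ (b * (k - b)))) := by
              rw [show k + 1 - b - 1 = k - b by omega]; ring
          _ = _ := by rw [layerCoeff_mul hb.1 hb.2.le]; ring
    _ ≤ ∑ b ∈ range (k + 1), (1 + 4 / (n : ℝ)) * ((2 ^ a - 1) ^ b * 2 ^ (k - b) * k.choose b) := by
        refine sum_le_sum_of_subset_of_nonneg (fun b hb => ?_) fun b _ _ => by positivity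
        have := mem_Ico.1 (mem_filter.1 hb).1
        exact mem_range.2 (by omega)
    _ = _ := by
        rw [← mul_sum, ← add_pow]
        congr 2
        ring

/-! ### Small layers are negligible -/

/-- The part of `layerWeight t k 1` in which the first new layer has fewer than `B` vertices. -/
noncomputable def smallLayerWeight (B : ℕ) : ℕ → ℕ → ℝ
  | 0, _ => 0
  | t + 1, k => ∑ b ∈ Ico 1 k with b < B, layerCoeff k b * layerWeight t (k + 1 - b) b

theorem smallLayerWeight_le (B t k : ℕ) (hk : 1 ≤ k) :
    smallLayerWeight B t k ≤ layerWeight t k 1 := by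
  cases t with
  | zero => exact layerWeight_nonneg 0 k 1 hk
  | succ t =>
    rw [smallLayerWeight, layerWeight]
    have h1 : ((2 : ℝ) ^ 1 - 1) = 1 := by norm_num
    simp only [h1, one_pow, mul_one]
    refine sum_le_sum_of_subset_of_nonneg ?_ fun b hb _ => ?_
    · exact filter_subset _ _
    have hb := mem_Ico.1 hb
    exact mul_nonneg (layerCoeff_nonneg _ _) (layerWeight_nonneg _ _ _ (by omega))

theorem smallLayerWeight_nonneg (B t k : ℕ) : 0 ≤ smallLayerWeight B t k := by
  cases t with
  | zero => exact le_rfl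
  | succ t =>
    refine sum_nonneg fun b hb => ?_
    have hb := mem_Ico.1 (mem_filter.1 hb).1
    exact mul_nonneg (layerCoeff_nonneg _ _) (layerWeight_nonneg _ _ _ (by omega))

/-- Replacing the starting size a by 1 changes a term with b < B only by the factor (2^a - 1)^b,
which is 1 for a = 1 and at most 2^(2(a-1)B) otherwise because a ≤ 2(a - 1). Thus the small part for
every a is controlled by a single function of k. -/
theorem layerWeight_le_add_small {n t k B a : ℕ} (hk : 2 ≤ k) (hkn : k + 1 ≤ n) (ht : t ≤ n)
    (hB : n ^ 8 ≤ 2 ^ B) (ha : 1 ≤ a) :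
    layerWeight t k a ≤
      (1 + 4 / n) * (2 ^ a + 1) ^ k + 2 ^ (2 * (a - 1) * B) * smallLayerWeight B t k := by
  have hn2 : (2 : ℝ) ≤ n := by exact_mod_cast (by omega : 2 ≤ n)
  have hpos := two_pow_sub_one_nonneg a
  cases t with
  | zero =>
    rw [smallLayerWeight, mul_zero, add_zero]
    calc _ ≤ 2 * (2 : ℝ) ^ (a * (k - 1)) := layerWeight_zero_le_two_mul hk
      _ = 2 ^ (a * (k - 1) + 1) := by rw [pow_succ]; ring
      _ ≤ 2 ^ (a * k) := by
        refine pow_le_pow_right₀ (by norm_num) ?_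
        obtain ⟨j, rfl⟩ := Nat.exists_eq_add_of_le' (show 1 ≤ k by omega)
        rw [Nat.add_sub_cancel]; nlinarith
      _ = 1 * (2 ^ a) ^ k := by rw [pow_mul, one_mul]
      _ ≤ _ := by
        gcongr
        · have : (0 : ℝ) ≤ 4 / n := by positivity
          linarith
        · linarith
  | succ t =>
    rw [layerWeight, ← sum_filter_add_sum_filter_not _ (fun b => b < B), add_comm]
    refine add_le_add (sum_large_layerWeight_le hkn (by omega) hB a) ?_
    rw [smallLayerWeight, mul_sum]
    refine sum_le_sum fun b hb => ?_
    obtain ⟨hb, hbB⟩ := mem_filter.1 hb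
    have hb := mem_Ico.1 hb
    have h1 := layerCoeff_nonneg k b
    have h2 := layerWeight_nonneg t (k + 1 - b) b (by omega)
    have h3 : ((2 : ℝ) ^ a - 1) ^ b ≤ 2 ^ (2 * (a - 1) * B) := by
      rcases ha.eq_or_lt with rfl | ha2
      · norm_num
      · calc ((2 : ℝ) ^ a - 1) ^ b ≤ (2 ^ a) ^ b := by gcongr; linarith
          _ = 2 ^ (a * b) := by rw [pow_mul]
          _ ≤ _ := by
            refine pow_le_pow_right₀ (by norm_num) ?_
            exact Nat.mul_le_mul (by omega) hbB.le
    calc _ = ((2 : ℝ) ^ a - 1) ^ b * (layerCoeff k b * layerWeight t (k + 1 - b) b) := by ring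
      _ ≤ _ := by gcongr

/-- A binomial coefficient with b < B is bounded by one term of the expansion of (1/10 + 1)^(m+1).
The weight 1/10 is chosen so that (5/2)(11/10) = 11/4 stays below 3. -/
theorem choose_mul_ten_pow_le {k m b B : ℕ} (hkm : k ≤ m) (hb : b < B) :
    ((k + 1).choose b : ℝ) * (5 / 2) ^ m ≤ 10 ^ B * (11 / 4) ^ m := by
  have h1 : ((k + 1).choose b : ℝ) ≤ (m + 1).choose b := by
    exact_mod_cast Nat.choose_le_choose b (by omega)
  have h2 : ((m + 1).choose b : ℝ) * (1 / 10) ^ b ≤ (11 / 10) ^ (m + 1) := by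
    rcases le_or_gt b (m + 1) with hbm | hbm
    · have := add_pow (1 / 10 : ℝ) 1 (m + 1)
      rw [show (1 / 10 + 1 : ℝ) = 11 / 10 by norm_num] at this
      rw [this]
      have := single_le_sum (f := fun j => (1 / 10 : ℝ) ^ j * 1 ^ (m + 1 - j) * (m + 1).choose j)
        (s := range (m + 1 + 1)) (fun j _ => by positivity) (mem_range.2 (by omega : b < m + 1 + 1))
      refine le_trans (le_of_eq ?_) this
      simp [mul_comm]
    · rw [Nat.choose_eq_zero_of_lt hbm]; simp; positivity
  calc ((k + 1).choose b : ℝ) * (5 / 2) ^ m ≤ (m + 1).choose b * (5 / 2) ^ m := by gcongr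
    _ = (((m + 1).choose b : ℝ) * (1 / 10) ^ b) * 10 ^ b * (5 / 2) ^ m := by
      rw [mul_assoc ((m + 1).choose b : ℝ), ← mul_pow]; norm_num
    _ ≤ (11 / 10) ^ (m + 1) * 10 ^ b * (5 / 2) ^ m := by gcongr
    _ = 10 ^ b * (11 / 10) * ((11 / 10) * (5 / 2)) ^ m := by rw [mul_pow]; ring
    _ ≤ 10 ^ b * 10 * ((11 / 10) * (5 / 2)) ^ m := by gcongr; norm_num
    _ = 10 ^ (b + 1) * (11 / 4) ^ m := by rw [pow_succ]; norm_num
    _ ≤ _ := by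
      gcongr
      · norm_num
      · omega

theorem ten_pow_mul_pow_le {m n B : ℕ} (hn : 1 ≤ n) (hB : n ^ 8 ≤ 2 ^ B) (hm : 100 * B ≤ m) :
    (10 : ℝ) ^ B * (11 / 4) ^ m ≤ 1 / n ^ 2 * 3 ^ m := by
  have hn1 : (1 : ℝ) ≤ n := by exact_mod_cast hn
  have hB' : (n : ℝ) ^ 8 ≤ 2 ^ B := by exact_mod_cast hB
  have h1 : (n : ℝ) ^ 2 ≤ 2 ^ B := (pow_le_pow_right₀ hn1 (by norm_num)).trans hB'
  have h2 : (20 : ℝ) ^ B ≤ (12 / 11) ^ m := by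
    calc (20 : ℝ) ^ B ≤ ((12 / 11) ^ 100) ^ B := by gcongr; norm_num
      _ = (12 / 11) ^ (100 * B) := by rw [pow_mul]
      _ ≤ _ := pow_le_pow_right₀ (by norm_num) hm
  rw [one_div, ← div_eq_inv_mul, le_div_iff₀ (by positivity)]
  calc (10 : ℝ) ^ B * (11 / 4) ^ m * n ^ 2 ≤ 10 ^ B * (11 / 4) ^ m * 2 ^ B := by gcongr
    _ = 20 ^ B * (11 / 4) ^ m := by
      rw [show (20 : ℝ) = 10 * 2 by norm_num, mul_pow]; ring
    _ ≤ (12 / 11) ^ m * (11 / 4) ^ m := by gcongr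
    _ = 3 ^ m := by rw [← mul_pow]; norm_num

/-- The contribution of the first new layers with at least `2` and fewer than `B` vertices is
negligible. -/
theorem sum_small_layerWeight_le {n t k m B : ℕ} (hn : 2 ≤ n) (hmn : m + 1 ≤ n) (ht : t ≤ n)
    (hB : n ^ 8 ≤ 2 ^ B) (hm : 100 * B ≤ m) (hkm : k ≤ m) (hmk : m ≤ 2 * k)
    (ih : ∀ k', 2 ≤ k' → k' ≤ m →
      smallLayerWeight B t k' ≤ 3 * t * 3 ^ m * 2 ^ (B * (m - k'))) :
    ∑ b ∈ Ico 2 k with b < B, layerCoeff k b * layerWeight t (k + 1 - b) b ≤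
      4 / n * (3 ^ m * 2 ^ (B * (m - k))) := by
  have hn2 : (2 : ℝ) ≤ n := by exact_mod_cast hn
  have htn : (t : ℝ) ≤ n := by exact_mod_cast ht
  have hB' : (n : ℝ) ^ 8 ≤ 2 ^ B := by exact_mod_cast hB
  have hterm : ∀ b ∈ (Ico 2 k).filter (· < B), layerCoeff k b * layerWeight t (k + 1 - b) b ≤
      4 / n ^ 2 * (3 ^ m * 2 ^ (B * (m - k))) := by
    intro b hb
    obtain ⟨hb, hbB⟩ := mem_filter.1 hb
    have hb := mem_Ico.1 hb
    have hc := layerCoeff_nonneg k b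
    have hone : (1 : ℝ) ≤ 2 ^ (B * (m - k)) := one_le_pow₀ (by norm_num)
    have h4n : (1 + 4 / n : ℝ) ≤ 3 := by
      have : (4 / n : ℝ) ≤ 2 := by rw [div_le_iff₀ (by linarith)]; linarith
      linarith
    -- For b ≥ 2 one has 2^b + 1 ≤ (5/4) 2^b, so the base falls from 3 to 5/2; this exponential gain
    -- absorbs the binomial coefficient and n^2 because m ≥ 100B.
    have hA : layerCoeff k b * (3 * (2 ^ b + 1) ^ (k + 1 - b)) ≤ 1 / n ^ 2 * 3 ^ m := by
      calc layerCoeff k b * (3 * ((2 : ℝ) ^ b + 1) ^ (k + 1 - b))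
          ≤ layerCoeff k b * (3 * (2 ^ b * (5 / 4)) ^ (k + 1 - b)) := by
            gcongr
            have : (2 : ℝ) ^ 2 ≤ 2 ^ b := pow_le_pow_right₀ (by norm_num) hb.1
            linarith
        _ = 3 * (layerCoeff k b * 2 ^ (b * (k - b))) * 2 ^ b * (5 / 4) ^ (k + 1 - b) := by
            rw [mul_pow, ← pow_mul, show b * (k + 1 - b) = b * (k - b) + b by
              rw [show k + 1 - b = k - b + 1 by omega]; ring, pow_add]
            ring
        _ = ((k + 1).choose b : ℝ) * (3 / (k + 1)) * 2 ^ k * (5 / 4) ^ (k + 1 - b) := by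
            rw [layerCoeff_mul_two_pow (by omega) hb.2.le]
            have : (2 : ℝ) ^ k = 2 ^ (k - b) * 2 ^ b := by rw [← pow_add]; congr 1; omega
            rw [this]; ring
        _ ≤ ((k + 1).choose b : ℝ) * 1 * 2 ^ m * (5 / 4) ^ m := by
            gcongr
            · rw [div_le_one (by positivity)]
              have : (2 : ℝ) ≤ k := by exact_mod_cast (by omega : 2 ≤ k)
              linarith
            · norm_num
            · norm_num
            · omega
        _ = ((k + 1).choose b : ℝ) * (5 / 2) ^ m := by
            rw [mul_one, mul_assoc, ← mul_pow]; norm_num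
        _ ≤ 10 ^ B * (11 / 4) ^ m := choose_mul_ten_pow_le hkm hbB
        _ ≤ _ := ten_pow_mul_pow_le (by omega) hB hm
    have hS : layerCoeff k b * (2 ^ (2 * (b - 1) * B) * smallLayerWeight B t (k + 1 - b)) ≤
        3 / n ^ 2 * (3 ^ m * 2 ^ (B * (m - k))) := by
      obtain ⟨c, rfl⟩ := Nat.exists_eq_add_of_le' (show 1 ≤ b by omega)
      -- Per unit of c = b - 1, the exponent 3B collects 2B from the comparison with starting size 1
      -- and B from the growth of m - k by c. It is beaten by k - b ≥ 4B, which holds since k ≥ m/2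
      -- ≥ 50B and b < B.
      have hr : (n : ℝ) * 2 ^ (3 * B) * (1 / 2) ^ (k - (c + 1)) ≤ 1 / n ^ 4 := by
        have e1 : (1 / 2 : ℝ) ^ (k - (c + 1)) ≤ (1 / 2) ^ (3 * B + B) :=
          pow_le_pow_of_le_one (by norm_num) (by norm_num) (by omega)
        rw [le_div_iff₀ (by positivity)]
        calc (n : ℝ) * 2 ^ (3 * B) * (1 / 2) ^ (k - (c + 1)) * (n : ℝ) ^ 4
            ≤ (n : ℝ) * 2 ^ (3 * B) * (1 / 2) ^ (3 * B + B) * (n : ℝ) ^ 4 := by gcongr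
          _ = (n : ℝ) ^ 5 * (1 / 2) ^ B * (2 * (1 / 2)) ^ (3 * B) := by
            rw [mul_pow, pow_add]; ring
          _ = (n : ℝ) ^ 5 / 2 ^ B := by
            rw [show (2 : ℝ) * (1 / 2) = 1 by norm_num, one_pow, one_div, inv_pow, mul_one,
              div_eq_mul_inv]
          _ ≤ 1 := by
            rw [div_le_one (by positivity)]
            exact (pow_le_pow_right₀ (by linarith) (by norm_num)).trans hB'
      have hr1 : (1 : ℝ) / n ^ 4 ≤ 1 := by
        rw [div_le_one (by positivity)]; exact one_le_pow₀ (by linarith)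
      have hcoef : layerCoeff k (c + 1) ≤ n ^ c * (1 / 2) ^ (c * (k - (c + 1))) := by
        unfold layerCoeff
        rw [Nat.add_sub_cancel]
        gcongr
        refine (choose_succ_div_le (by omega)).trans ?_
        rw [Nat.add_sub_cancel]
        gcongr
        exact_mod_cast (by omega : k + 1 ≤ n)
      have hσ := ih (k + 1 - (c + 1)) (by omega) (by omega)
      have hσ0 := smallLayerWeight_nonneg B t (k + 1 - (c + 1))
      rw [show m - (k + 1 - (c + 1)) = (m - k) + c by omega] at hσ
      rw [Nat.add_sub_cancel]
      calc _ ≤ ((n : ℝ) ^ c * (1 / 2) ^ (c * (k - (c + 1)))) *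
            (2 ^ (2 * c * B) * (3 * n * 3 ^ m * 2 ^ (B * (m - k + c)))) := by
            gcongr
            exact hσ.trans (by gcongr)
        _ = ((n : ℝ) * 2 ^ (3 * B) * (1 / 2) ^ (k - (c + 1))) ^ c *
            (3 * n * (3 ^ m * 2 ^ (B * (m - k)))) := by ring
        _ ≤ (1 / n ^ 4) ^ c * (3 * n * (3 ^ m * 2 ^ (B * (m - k)))) := by gcongr
        _ ≤ (1 / n ^ 4) ^ 1 * (3 * n * (3 ^ m * 2 ^ (B * (m - k)))) := by
            have := pow_le_pow_of_le_one (by positivity) hr1 (show 1 ≤ c by omega)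
            gcongr
        _ = (3 / n ^ 3) * (3 ^ m * 2 ^ (B * (m - k))) := by field_simp
        _ ≤ _ := by
            gcongr
            · linarith
            · norm_num
    calc _ ≤ layerCoeff k b * ((1 + 4 / n) * (2 ^ b + 1) ^ (k + 1 - b) +
          2 ^ (2 * (b - 1) * B) * smallLayerWeight B t (k + 1 - b)) := by
          gcongr
          exact layerWeight_le_add_small (by omega) (by omega) ht hB (by omega)
      _ ≤ layerCoeff k b * (3 * (2 ^ b + 1) ^ (k + 1 - b) +
          2 ^ (2 * (b - 1) * B) * smallLayerWeight B t (k + 1 - b)) := by gcongr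
      _ ≤ 1 / n ^ 2 * 3 ^ m + 3 / n ^ 2 * (3 ^ m * 2 ^ (B * (m - k))) := by
          rw [mul_add]; exact add_le_add hA hS
      _ ≤ 1 / n ^ 2 * (3 ^ m * 2 ^ (B * (m - k))) +
          3 / n ^ 2 * (3 ^ m * 2 ^ (B * (m - k))) := by
          gcongr
          exact le_mul_of_one_le_right (by positivity) hone
      _ = _ := by ring
  refine (sum_le_card_nsmul _ _ _ hterm).trans ?_
  rw [nsmul_eq_mul]
  have hcard : (#((Ico 2 k).filter (· < B)) : ℝ) ≤ n := by
    have := card_filter_le (Ico 2 k) (· < B)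
    rw [Nat.card_Ico] at this
    exact_mod_cast (by omega : #((Ico 2 k).filter (· < B)) ≤ n)
  calc _ ≤ (n : ℝ) * (4 / n ^ 2 * (3 ^ m * 2 ^ (B * (m - k)))) := by gcongr
    _ = _ := by field_simp

theorem layerCoeff_one {k : ℕ} : layerCoeff k 1 = 1 := by
  unfold layerCoeff
  rw [Nat.choose_one_right]
  push_cast
  rw [div_self (by positivity)]
  simp

theorem filter_lt_Ico_one {k B : ℕ} (hk : 2 ≤ k) (hB : 2 ≤ B) :
    (Ico 1 k).filter (· < B) = insert 1 ((Ico 2 k).filter (· < B)) := by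
  ext x
  simp only [mem_filter, mem_Ico, mem_insert]
  omega

theorem sum_filter_lt_layerWeight {t k B : ℕ} (hk : 2 ≤ k) (hB : 2 ≤ B) :
    ∑ b ∈ Ico 1 k with b < B, layerCoeff k b * layerWeight t (k + 1 - b) b =
      layerWeight t k 1 +
        ∑ b ∈ Ico 2 k with b < B, layerCoeff k b * layerWeight t (k + 1 - b) b := by
  rw [filter_lt_Ico_one hk hB, sum_insert (by simp), layerCoeff_one, one_mul, Nat.add_sub_cancel]

/-- The slack 2^(B(m-k)) makes the induction close: it grows when the recursion lowers k, and that
growth is paid for by the factor (1/2)^((b-1)(k-b)) in `layerCoeff`. At each step the layers of size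
at least B and those with 2 ≤ b < B add at most 3 * 3^m times the slack. -/
theorem smallLayerWeight_le_mul {n t k m B : ℕ} (hn : 8 ≤ n) (hmn : m + 1 ≤ n) (ht : t + 1 ≤ n)
    (hB : n ^ 8 ≤ 2 ^ B) (hm : 100 * B ≤ m) (hk : 2 ≤ k) (hkm : k ≤ m) :
    smallLayerWeight B t k ≤ 3 * t * 3 ^ m * 2 ^ (B * (m - k)) := by
  have hn2 : (8 : ℝ) ≤ n := by exact_mod_cast hn
  have hB2 : 2 ≤ B := by
    by_contra! h
    have h1 : 8 ^ 8 ≤ n ^ 8 := Nat.pow_le_pow_left hn 8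
    have h2 : 2 ^ B ≤ 2 ^ 1 := Nat.pow_le_pow_right (by norm_num) (by omega)
    omega
  have hB' : (n : ℝ) ^ 8 ≤ 2 ^ B := by exact_mod_cast hB
  induction t generalizing k with
  | zero => simp [smallLayerWeight]
  | succ t ih =>
    have hone : (1 : ℝ) ≤ 2 ^ (B * (m - k)) := one_le_pow₀ (by norm_num)
    -- When k < m/2 the slack alone exceeds the crude bound, since 2^(B(m-k)) ≥ n^(8(m-k)) and m - k
    -- > k.
    rcases le_or_gt m (2 * k) with hmk | hmk
    · rw [smallLayerWeight, sum_filter_lt_layerWeight hk hB2]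
      have h1 := sum_small_layerWeight_le (by omega) hmn (show t ≤ n by omega) hB hm hkm hmk
        (fun k' h1 h2 => ih (by omega) h1 h2)
      have h2 := layerWeight_le_add_small (n := n) (t := t) (k := k) (B := B) (a := 1) hk (by omega)
        (by omega) hB le_rfl
      have h3 := ih (by omega) hk hkm
      rw [Nat.sub_self, Nat.mul_zero, Nat.zero_mul, pow_zero, one_mul] at h2
      have h4 : ((2 : ℝ) ^ 1 + 1) ^ k ≤ 3 ^ m * 2 ^ (B * (m - k)) := by
        calc ((2 : ℝ) ^ 1 + 1) ^ k = 3 ^ k * 1 := by norm_num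
          _ ≤ _ := by
            gcongr
            norm_num
      have h5 : (4 / n : ℝ) ≤ 1 / 2 := by rw [div_le_iff₀ (by linarith)]; linarith
      set Q : ℝ := 3 ^ m * 2 ^ (B * (m - k)) with hQ
      have hQ0 : 0 < Q := by positivity
      calc _ ≤ ((1 + 4 / n) * ((2 : ℝ) ^ 1 + 1) ^ k + 3 * t * 3 ^ m * 2 ^ (B * (m - k))) +
            4 / n * Q := add_le_add (h2.trans (by gcongr)) h1
        _ ≤ ((1 + 1 / 2) * Q + 3 * t * 3 ^ m * 2 ^ (B * (m - k))) + 1 / 2 * Q := by gcongr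
        _ = 2 * Q + 3 * t * Q := by rw [hQ]; ring
        _ ≤ 3 * Q + 3 * t * Q := by linarith
        _ = _ := by rw [hQ]; push_cast; ring
    · calc _ ≤ layerWeight (t + 1) k 1 := smallLayerWeight_le _ _ _ (by omega)
        _ ≤ (n : ℝ) ^ (4 * (k - 2)) * 2 ^ (1 * (k - 1)) :=
          layerWeight_le_pow hk (by omega) (by omega)
        _ ≤ (n : ℝ) ^ (4 * (k - 2)) * n ^ (1 * (k - 1)) := by gcongr; linarith
        _ = (n : ℝ) ^ (4 * (k - 2) + 1 * (k - 1)) := by rw [pow_add]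
        _ ≤ (n : ℝ) ^ (8 * (m - k)) := pow_le_pow_right₀ (by linarith) (by omega)
        _ ≤ 2 ^ (B * (m - k)) := by rw [pow_mul, pow_mul]; gcongr
        _ ≤ 3 * ((t + 1 : ℕ) : ℝ) * 3 ^ m * 2 ^ (B * (m - k)) := by
          refine le_mul_of_one_le_left (by positivity) ?_
          have h1 : (1 : ℝ) ≤ 3 ^ m := one_le_pow₀ (by norm_num)
          have h2 : (0 : ℝ) ≤ t := Nat.cast_nonneg t
          push_cast
          nlinarith

/-- With two layers in all, no singleton follows the wide pair, so each vertex has two choices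
instead of three and the sum is of order 2^m up to a polynomial. This base case explains why d - 2,
not d - 1, positions count. -/
theorem layerWeight_one_one_le {m : ℕ} (hm : 2 ≤ m) : layerWeight 1 m 1 ≤ m * 2 ^ m := by
  rw [layerWeight]
  calc _ ≤ ∑ b ∈ Ico 1 m, (m : ℝ) * m.choose b := by
        refine sum_le_sum fun b hb => ?_
        have hb := mem_Ico.1 hb
        have hw := layerWeight_zero_le (k := m + 1 - b) (a := b) (by omega)
        have hc := layerCoeff_nonneg m b
        rw [show m + 1 - b - 1 = m - b by omega] at hw
        have hle : (((m + 1 - b : ℕ) : ℝ) - 1) ≤ m := by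
          have : ((m + 1 - b : ℕ) : ℝ) ≤ m := by exact_mod_cast (by omega : m + 1 - b ≤ m)
          linarith
        have h1 : ((2 : ℝ) ^ 1 - 1) = 1 := by norm_num
        rw [h1, one_pow, mul_one]
        calc _ ≤ layerCoeff m b * (((m + 1 - b : ℕ) : ℝ) * m * (1 / 2) ^ (m - b) *
              2 ^ (b * (m - b))) := by
              gcongr
              exact hw.trans (by gcongr)
          _ = m * (1 / 2) ^ (m - b) *
              (layerCoeff m b * ((m + 1 - b : ℕ) * 2 ^ (b * (m - b)))) := by ring
          _ = m * m.choose b * ((1 / 2) * 2) ^ (m - b) := by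
              rw [layerCoeff_mul hb.1 hb.2.le, mul_pow]; ring
          _ = _ := by norm_num
    _ ≤ ∑ b ∈ range (m + 1), (m : ℝ) * m.choose b := by
        refine sum_le_sum_of_subset_of_nonneg (fun b hb => ?_) fun b _ _ => by positivity
        have := mem_Ico.1 hb
        exact mem_range.2 (by omega)
    _ = _ := by
        rw [← mul_sum]
        congr 1
        exact_mod_cast Nat.sum_range_choose m

/-- One more step adds about 3^m: the term b = 1 reproduces the previous weight with coefficient 1,
the terms b ≥ B add (1 + 4/n)3^m, and the remaining ones at most (4/n)3^m. -/
theorem layerWeight_one_le {n t m B : ℕ} (hn : 8 ≤ n) (hmn : m + 1 ≤ n) (ht : t + 2 ≤ n)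
    (hB : n ^ 8 ≤ 2 ^ B) (hm : 100 * B ≤ m) :
    layerWeight (t + 1) m 1 ≤ (t * (1 + 8 / n) + 1 / n) * 3 ^ m := by
  have hn2 : (8 : ℝ) ≤ n := by exact_mod_cast hn
  have hB2 : 2 ≤ B := by
    by_contra! h
    have h1 : 8 ^ 8 ≤ n ^ 8 := Nat.pow_le_pow_left hn 8
    have h2 : 2 ^ B ≤ 2 ^ 1 := Nat.pow_le_pow_right (by norm_num) (by omega)
    omega
  have hB' : (n : ℝ) ^ 8 ≤ 2 ^ B := by exact_mod_cast hB
  induction t with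
  | zero =>
    refine (layerWeight_one_one_le (by omega)).trans ?_
    have h1 : (2 : ℝ) ^ B ≤ (3 / 2) ^ m := by
      calc (2 : ℝ) ^ B ≤ ((3 / 2) ^ 100) ^ B := by gcongr; norm_num
        _ = (3 / 2) ^ (100 * B) := by rw [pow_mul]
        _ ≤ _ := pow_le_pow_right₀ (by norm_num) hm
    have h2 : (n : ℝ) ^ 2 ≤ 2 ^ B := (pow_le_pow_right₀ (by linarith) (by norm_num)).trans hB'
    have h3 : (m : ℝ) ≤ n := by exact_mod_cast (by omega : m ≤ n)
    rw [Nat.cast_zero, zero_mul, zero_add, one_div, ← div_eq_inv_mul, le_div_iff₀ (by linarith)]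
    calc (m : ℝ) * 2 ^ m * n ≤ n * 2 ^ m * n := by gcongr
      _ = n ^ 2 * 2 ^ m := by ring
      _ ≤ (3 / 2) ^ m * 2 ^ m := by gcongr; exact h2.trans h1
      _ = 3 ^ m := by rw [← mul_pow]; norm_num
  | succ t ih =>
    have h1 : ((2 : ℝ) ^ 1 - 1) = 1 := by norm_num
    rw [layerWeight, ← sum_filter_add_sum_filter_not _ (fun b => b < B)]
    have h2 := sum_large_layerWeight_le (n := n) (t := t + 1) (k := m) hmn (by omega) hB 1
    have h3 := sum_small_layerWeight_le (t := t + 1) (by omega) hmn (by omega) hB hm le_rfl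
      (by omega) (fun k' h1 h2 => smallLayerWeight_le_mul hn hmn (by omega) hB hm h1 h2)
    simp only [h1, one_pow, mul_one] at h2 ⊢
    rw [sum_filter_lt_layerWeight (by omega) hB2]
    rw [Nat.sub_self, Nat.mul_zero, pow_zero, mul_one] at h3
    rw [pow_one, show (2 : ℝ) + 1 = 3 by norm_num] at h2
    have h5 := ih (by omega)
    calc _ ≤ (t * (1 + 8 / n) + 1 / n) * (3 : ℝ) ^ m + 4 / n * 3 ^ m + (1 + 4 / n) * 3 ^ m :=
          add_le_add (add_le_add h5 h3) h2
      _ = _ := by push_cast; ring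

/-! ### Counting graphs by breadth-first layers -/

theorem card_simpleGraph (V : Type*) [Fintype V] :
    Nat.card (SimpleGraph V) = 2 ^ (Fintype.card V).choose 2 := by
  classical
  let e : SimpleGraph V ≃ Set {e : Sym2 V // ¬ e.IsDiag} :=
    { toFun := fun G => {e | e.1 ∈ G.edgeSet}
      invFun := fun s => SimpleGraph.fromEdgeSet (Subtype.val '' s)
      left_inv := fun G => by
        ext x y
        simp only [SimpleGraph.fromEdgeSet_adj, Set.mem_image, Set.mem_ofPred_eq, Subtype.exists]
        constructor
        · rintro ⟨⟨e, -, he, rfl⟩, -⟩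
          exact he
        · intro h
          exact ⟨⟨s(x, y), by simpa using h.ne, h, rfl⟩, h.ne⟩
      right_inv := fun s => by
        ext ⟨e, he⟩
        simp [SimpleGraph.edgeSet_fromEdgeSet, he] }
  rw [Nat.card_congr e, Nat.card_eq_fintype_card, Fintype.card_set, Sym2.card_subtype_not_diag]

section layers

variable {V : Type*}

open Classical in
/-- The vertices of `R` with a neighbour in `A`. -/
noncomputable def nextLayer (G : SimpleGraph V) (A R : Finset V) : Finset V :=
  {v ∈ R | ∃ a ∈ A, G.Adj a v}

theorem mem_nextLayer {G : SimpleGraph V} {A R : Finset V} {v : V} :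
    v ∈ nextLayer G A R ↔ v ∈ R ∧ ∃ a ∈ A, G.Adj a v := by
  simp [nextLayer]

theorem nextLayer_subset (G : SimpleGraph V) (A R : Finset V) : nextLayer G A R ⊆ R :=
  fun _ h => (mem_nextLayer.1 h).1

open Classical in
/-- The neighbours of `v` in `A`. -/
noncomputable def nbrsIn (G : SimpleGraph V) (A : Finset V) (v : V) : Finset V :=
  {a ∈ A | G.Adj a v}

theorem mem_nbrsIn {G : SimpleGraph V} {A : Finset V} {v a : V} :
    a ∈ nbrsIn G A v ↔ a ∈ A ∧ G.Adj a v := by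
  simp [nbrsIn]

theorem nbrsIn_mem_powerset (G : SimpleGraph V) (A : Finset V) (v : V) :
    nbrsIn G A v ∈ A.powerset :=
  mem_powerset.2 fun _ h => (mem_nbrsIn.1 h).1

variable [DecidableEq V]

/-- `w` lies in the `t + 1`-st layer of the breadth-first search in `R` that starts from `A`. -/
def LayerReach (G : SimpleGraph V) (w : V) : ℕ → Finset V → Finset V → Prop
  | 0, A, R => w ∈ nextLayer G A R
  | t + 1, A, R => LayerReach G w t (nextLayer G A R) (R \ nextLayer G A R)

/-- The edges with one end in `R` and the other in `A ∪ R`. -/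
def layerEdge (A R : Finset V) (x y : V) : Prop :=
  (x ∈ R ∧ y ∈ A ∪ R) ∨ (y ∈ R ∧ x ∈ A ∪ R)

/-- The graphs with edges between `R` and `A ∪ R` together with a vertex in the `t + 1`-st layer
of the breadth-first search that starts from `A`. -/
def layeredGraphs (t : ℕ) (A R : Finset V) : Set (SimpleGraph V × V) :=
  {p | (∀ x y, p.1.Adj x y → layerEdge A R x y) ∧ LayerReach p.1 p.2 t A R}

/-- An upper bound for the number of `layeredGraphs`, for `A` of size `a` and `R` of size `N`. -/
def layerCount : ℕ → ℕ → ℕ → ℕ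
  | 0, N, a => N * (2 ^ a - 1) * 2 ^ (a * (N - 1)) * 2 ^ N.choose 2
  | t + 1, N, a => ∑ b ∈ range (N + 1),
      N.choose b * 2 ^ b.choose 2 * (2 ^ a - 1) ^ b * layerCount t (N - b) b

/-- The search never looks at edges inside `A`, so these may be deleted before the remaining graph
is counted. -/
theorem layerReach_congr {G G' : SimpleGraph V} {w : V} {t : ℕ} {A R : Finset V}
    (h : ∀ x ∈ A ∪ R, ∀ y ∈ R, G.Adj x y ↔ G'.Adj x y) :
    LayerReach G w t A R ↔ LayerReach G' w t A R := by
  have hn : nextLayer G A R = nextLayer G' A R := by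
    ext v
    rw [mem_nextLayer, mem_nextLayer]
    refine and_congr_right fun hv => exists_congr fun a => and_congr_right fun ha => ?_
    exact h a (mem_union_left _ ha) v hv
  induction t generalizing A R with
  | zero => rw [LayerReach, LayerReach, hn]
  | succ t ih =>
    rw [LayerReach, LayerReach, hn]
    have h' : ∀ x ∈ nextLayer G' A R ∪ (R \ nextLayer G' A R), ∀ y ∈ R \ nextLayer G' A R,
        G.Adj x y ↔ G'.Adj x y := by
      intro x hx y hy
      rw [union_sdiff_of_subset (nextLayer_subset _ _ _)] at hx
      exact h x (mem_union_right _ hx) y (mem_sdiff.1 hy).1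
    refine ih h' ?_
    ext v
    rw [mem_nextLayer, mem_nextLayer]
    refine and_congr_right fun hv => exists_congr fun a => and_congr_right fun ha => ?_
    exact h' a (mem_union_left _ ha) v hv

/-- The subgraph of the edges with one end in `R` and the other in `A ∪ R`. -/
def restrictLayer (G : SimpleGraph V) (A R : Finset V) : SimpleGraph V where
  Adj x y := G.Adj x y ∧ layerEdge A R x y
  symm := ⟨fun _ _ h => ⟨h.1.symm, h.2.symm⟩⟩
  loopless := ⟨fun _ h => G.loopless.irrefl _ h.1⟩

theorem nbrsIn_mem_erase {G : SimpleGraph V} {A R : Finset V} {v : V}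
    (h : v ∈ nextLayer G A R) : nbrsIn G A v ∈ A.powerset.erase ∅ := by
  obtain ⟨a, ha, hav⟩ := (mem_nextLayer.1 h).2
  exact mem_erase.2 ⟨ne_empty_of_mem (mem_nbrsIn.2 ⟨ha, hav⟩), nbrsIn_mem_powerset _ _ _⟩

theorem card_powerset_erase_empty (A : Finset V) : #(A.powerset.erase ∅) = 2 ^ #A - 1 := by
  rw [card_erase_of_mem (empty_mem_powerset A), card_powerset]

/-- The graph is encoded by the nonempty neighbourhood of w in `A`, arbitrary neighbourhoods in `A`
of the other vertices of `R`, and the graph induced on `R`. -/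
theorem ncard_layeredGraphs_fiber_zero_le [Fintype V] (A R : Finset V) {w : V} (hw : w ∈ R) :
    {p ∈ layeredGraphs 0 A R | p.2 = w}.ncard ≤
      (2 ^ #A - 1) * 2 ^ (#A * (#R - 1)) * 2 ^ (#R).choose 2 := by
  let T := (A.powerset.erase ∅) × (↥(R.erase w) → ↥A.powerset) × SimpleGraph ↥R
  have hT : Nat.card T = (2 ^ #A - 1) * 2 ^ (#A * (#R - 1)) * 2 ^ (#R).choose 2 := by
    simp only [T, Nat.card_prod, Nat.card_fun, Nat.card_eq_finsetCard, card_powerset_erase_empty,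
      card_powerset, card_simpleGraph, Fintype.card_coe, card_erase_of_mem hw]
    rw [← pow_mul, mul_assoc]
  rw [← hT, ← Nat.card_coe_set_eq]
  let f : {p ∈ layeredGraphs 0 A R | p.2 = w} → T := fun p =>
    (⟨nbrsIn p.1.1 A w, nbrsIn_mem_erase (R := R) (by
        have h1 : LayerReach p.1.1 p.1.2 0 A R := p.2.1.2
        rw [p.2.2] at h1
        exact h1)⟩,
      fun v => ⟨nbrsIn p.1.1 A v, nbrsIn_mem_powerset _ _ _⟩, p.1.1.induce R)
  refine Nat.card_le_card_of_injective f ?_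
  rintro ⟨⟨G, w₁⟩, ⟨hG, _⟩, rfl⟩ ⟨⟨G', w'⟩, ⟨hG', _⟩, h⟩ hf
  obtain rfl : w' = w₁ := h
  have h1 : nbrsIn G A w' = nbrsIn G' A w' := congrArg (fun q : T => q.1.1) hf
  have h2 := congrArg (fun q : T => q.2.1) hf
  have h3 : G.induce R = G'.induce R := congrArg (fun q : T => q.2.2) hf
  have hnb : ∀ v ∈ R, nbrsIn G A v = nbrsIn G' A v := by
    intro v hv
    by_cases hvw : v = w'
    · rw [hvw]; exact h1
    · have := congrFun h2 ⟨v, mem_erase.2 ⟨hvw, hv⟩⟩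
      exact congrArg Subtype.val this
  have hA : ∀ a ∈ A, ∀ v ∈ R, G.Adj a v ↔ G'.Adj a v := by
    intro a ha v hv
    have := congrArg (a ∈ ·) (hnb v hv)
    simpa [mem_nbrsIn, ha] using this
  have hR : ∀ x ∈ R, ∀ y ∈ R, G.Adj x y ↔ G'.Adj x y := by
    intro x hx y hy
    have := congrArg (fun H : SimpleGraph ↥R => H.Adj ⟨x, hx⟩ ⟨y, hy⟩) h3
    simpa using this
  have key : ∀ x y, layerEdge A R x y → (G.Adj x y ↔ G'.Adj x y) := by
    rintro x y (⟨hx, hy⟩ | ⟨hy, hx⟩)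
    · rcases mem_union.1 hy with hy | hy
      · rw [G.adj_comm, G'.adj_comm, hA y hy x hx]
      · exact hR x hx y hy
    · rcases mem_union.1 hx with hx | hx
      · exact hA x hx y hy
      · exact hR x hx y hy
  have : G = G' := by
    ext x y
    exact ⟨fun h => (key x y (hG x y h)).1 h, fun h => (key x y (hG' x y h)).2 h⟩
  subst this
  rfl

/-- Once the first layer `B` is fixed, the rest of `R` has no neighbours in `A`. So the graph is
encoded by its restriction to `B`, the nonempty neighbourhoods of the vertices of `B` in `A`, and a
layered graph that starts from `B`. -/
theorem ncard_layeredGraphs_fiber_succ_le [Fintype V] (t : ℕ) (A R : Finset V) {B : Finset V}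
    (hB : B ⊆ R) :
    {p ∈ layeredGraphs (t + 1) A R | nextLayer p.1 A R = B}.ncard ≤
      2 ^ (#B).choose 2 * (2 ^ #A - 1) ^ #B * (layeredGraphs t B (R \ B)).ncard := by
  let T := SimpleGraph ↥B × (↥B → ↥(A.powerset.erase ∅)) × ↥(layeredGraphs t B (R \ B))
  have hT : Nat.card T =
      2 ^ (#B).choose 2 * (2 ^ #A - 1) ^ #B * (layeredGraphs t B (R \ B)).ncard := by
    simp only [T, Nat.card_prod, Nat.card_fun, Nat.card_eq_finsetCard, card_powerset_erase_empty,
      card_simpleGraph, Fintype.card_coe, Nat.card_coe_set_eq]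
    rw [mul_assoc]
  rw [← hT, ← Nat.card_coe_set_eq]
  let f : {p ∈ layeredGraphs (t + 1) A R | nextLayer p.1 A R = B} → T := fun p =>
    (p.1.1.induce B, fun v => ⟨nbrsIn p.1.1 A v, nbrsIn_mem_erase (R := R) (by
        rw [p.2.2]; exact v.2)⟩,
      ⟨(restrictLayer p.1.1 B (R \ B), p.1.2), fun x y h => h.2, by
        have h1 : LayerReach p.1.1 p.1.2 (t + 1) A R := p.2.1.2
        rw [LayerReach, p.2.2] at h1
        refine (layerReach_congr fun x hx y hy => ?_).1 h1
        exact ⟨fun h => ⟨h, Or.inr ⟨hy, hx⟩⟩, fun h => h.1⟩⟩)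
  refine Nat.card_le_card_of_injective f ?_
  rintro ⟨⟨G, w⟩, ⟨hG, _⟩, hGB⟩ ⟨⟨G', w'⟩, ⟨hG', _⟩, hGB'⟩ hf
  have h1 : G.induce B = G'.induce B := congrArg (fun q : T => q.1) hf
  have h2 := congrArg (fun q : T => q.2.1) hf
  have h3 : restrictLayer G B (R \ B) = restrictLayer G' B (R \ B) :=
    congrArg (fun q : T => q.2.2.1.1) hf
  obtain rfl : w = w' := congrArg (fun q : T => q.2.2.1.2) hf
  dsimp only at hG hG' hGB hGB'
  have hA : ∀ a ∈ A, ∀ v ∈ R, G.Adj a v ↔ G'.Adj a v := by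
    intro a ha v hv
    by_cases hvB : v ∈ B
    · have hv : nbrsIn G A v = nbrsIn G' A v := congrArg Subtype.val (congrFun h2 ⟨v, hvB⟩)
      have := congrArg (a ∈ ·) hv
      simpa [mem_nbrsIn, ha] using this
    · refine iff_of_false (fun h => hvB ?_) (fun h => hvB ?_)
      · rw [← hGB]; exact mem_nextLayer.2 ⟨hv, a, ha, h⟩
      · rw [← hGB']; exact mem_nextLayer.2 ⟨hv, a, ha, h⟩
  have hR : ∀ x ∈ R, ∀ y ∈ R, G.Adj x y ↔ G'.Adj x y := by
    intro x hx y hy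
    by_cases hxy : x ∈ B ∧ y ∈ B
    · have := congrArg (fun H : SimpleGraph ↥B => H.Adj ⟨x, hxy.1⟩ ⟨y, hxy.2⟩) h1
      simpa using this
    · have hE : layerEdge B (R \ B) x y := by
        unfold layerEdge
        rw [union_sdiff_of_subset hB]
        by_cases hxB : x ∈ B
        · exact Or.inr ⟨mem_sdiff.2 ⟨hy, fun h => hxy ⟨hxB, h⟩⟩, hx⟩
        · exact Or.inl ⟨mem_sdiff.2 ⟨hx, hxB⟩, hy⟩
      have := congrArg (fun H : SimpleGraph V => H.Adj x y) h3
      simpa [restrictLayer, hE] using this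
  have key : ∀ x y, layerEdge A R x y → (G.Adj x y ↔ G'.Adj x y) := by
    rintro x y (⟨hx, hy⟩ | ⟨hy, hx⟩)
    · rcases mem_union.1 hy with hy | hy
      · rw [G.adj_comm, G'.adj_comm, hA y hy x hx]
      · exact hR x hx y hy
    · rcases mem_union.1 hx with hx | hx
      · exact hA x hx y hy
      · exact hR x hx y hy
  have : G = G' := by
    ext x y
    exact ⟨fun h => (key x y (hG x y h)).1 h, fun h => (key x y (hG' x y h)).2 h⟩
  subst this
  rfl

theorem LayerReach.mem {G : SimpleGraph V} {w : V} {t : ℕ} {A R : Finset V}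
    (h : LayerReach G w t A R) : w ∈ R := by
  induction t generalizing A R with
  | zero => exact nextLayer_subset _ _ _ h
  | succ t ih => exact (mem_sdiff.1 (ih h)).1

theorem ncard_layeredGraphs_le [Fintype V] (t : ℕ) (A R : Finset V) :
    (layeredGraphs t A R).ncard ≤ layerCount t #R #A := by
  induction t generalizing A R with
  | zero =>
    have hsub : layeredGraphs 0 A R ⊆ ⋃ w ∈ R, {p ∈ layeredGraphs 0 A R | p.2 = w} := by
      intro p hp
      simp only [Set.mem_iUnion]
      exact ⟨p.2, LayerReach.mem hp.2, hp, rfl⟩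
    refine (Set.ncard_le_ncard hsub (Set.toFinite _)).trans ?_
    refine (R.set_ncard_biUnion_le _).trans ?_
    refine (sum_le_card_nsmul _ _ _ fun w hw => ncard_layeredGraphs_fiber_zero_le A R hw).trans ?_
    rw [layerCount, smul_eq_mul, mul_assoc, mul_assoc, mul_assoc]
  | succ t ih =>
    have hsub : layeredGraphs (t + 1) A R ⊆
        ⋃ B ∈ R.powerset, {p ∈ layeredGraphs (t + 1) A R | nextLayer p.1 A R = B} := by
      intro p hp
      simp only [Set.mem_iUnion]
      exact ⟨_, mem_powerset.2 (nextLayer_subset p.1 A R), hp, rfl⟩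
    refine (Set.ncard_le_ncard hsub (Set.toFinite _)).trans ?_
    refine (R.powerset.set_ncard_biUnion_le _).trans ?_
    have : ∀ B ∈ R.powerset,
        {p ∈ layeredGraphs (t + 1) A R | nextLayer p.1 A R = B}.ncard ≤
          2 ^ (#B).choose 2 * (2 ^ #A - 1) ^ #B * layerCount t (#R - #B) #B := by
      intro B hB
      refine (ncard_layeredGraphs_fiber_succ_le t A R (mem_powerset.1 hB)).trans ?_
      refine Nat.mul_le_mul_left _ ((ih B (R \ B)).trans_eq ?_)
      rw [card_sdiff_of_subset (mem_powerset.1 hB)]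
    refine (sum_le_sum this).trans_eq ?_
    rw [sum_powerset_apply_card (fun b => 2 ^ b.choose 2 * (2 ^ #A - 1) ^ b *
      layerCount t (#R - b) b), layerCount]
    refine sum_congr rfl fun b _ => ?_
    rw [smul_eq_mul]; ring

end layers

/-! ### From layer counts to normalised weights -/

theorem layerCount_zero_right (t N : ℕ) : layerCount t N 0 = 0 := by
  induction t generalizing N with
  | zero => simp [layerCount]
  | succ t ih =>
    rw [layerCount]
    refine sum_eq_zero fun b _ => ?_
    rcases Nat.eq_zero_or_pos b with rfl | hb
    · rw [ih]; simp
    · rw [pow_zero, Nat.sub_self, zero_pow (by omega)]; simp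

theorem layerCount_eq_zero {t N : ℕ} (h : N ≤ t) (a : ℕ) : layerCount t N a = 0 := by
  induction t generalizing N a with
  | zero =>
    obtain rfl : N = 0 := by omega
    simp [layerCount]
  | succ t ih =>
    rw [layerCount]
    refine sum_eq_zero fun b _ => ?_
    rcases Nat.eq_zero_or_pos b with rfl | hb
    · rw [layerCount_zero_right]; simp
    · rw [ih (by omega)]; simp

/-- With b = c + 1 and k = b + e, the cross term is the exponent (b - 1)(k - b) in `layerCoeff`. -/
theorem choose_two_add (c e : ℕ) :
    (c + 1 + e).choose 2 = (c + 1).choose 2 + (e + 1).choose 2 + c * e := by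
  have h : ((c + 1 + e).choose 2 : ℚ) = ((c + 1).choose 2 + (e + 1).choose 2 + c * e : ℕ) := by
    push_cast [Nat.cast_choose_two]
    ring
  exact_mod_cast h

/-- The parameter k is one more than the number of vertices in excess of one per layer, plus one: it
counts the vertices available to a pair of wide layers when all others are singletons. For N = n - 1
and t = d - 1 it is n - d + 1. Only 1 ≤ b < k survives in the sum, since an empty layer, or too few
vertices for the remaining layers, gives 0. -/
theorem layerCount_eq {t k N : ℕ} (hk : 2 ≤ k) (hN : N + 1 = k + t) (a : ℕ) :
    (layerCount t N a : ℝ) =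
      N.factorial / k.factorial * 2 ^ k.choose 2 * layerWeight t k a := by
  induction t generalizing k N a with
  | zero =>
    obtain ⟨j, rfl⟩ := Nat.exists_eq_add_of_le' hk
    obtain rfl : N = j + 1 := by omega
    have h1 : (j + 2).choose 2 = (j + 1).choose 2 + (j + 1) := by
      have := choose_two_add j 1
      rw [this]; simp; omega
    rw [layerCount, layerWeight, h1, Nat.factorial_succ (j + 1)]
    have hf : ((j + 1).factorial : ℝ) ≠ 0 := by positivity
    rw [show j + 2 - 1 = j + 1 by omega, show j + 1 - 1 = j by omega,
      show j + 2 - 2 = j by omega, pow_add, one_div, inv_pow]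
    push_cast [Nat.one_le_two_pow]
    field_simp
    ring
  | succ t ih =>
    have hsub : Ico 1 k ⊆ range (N + 1) := fun b hb => by
      have := mem_Ico.1 hb
      exact mem_range.2 (by omega)
    rw [layerCount, layerWeight, ← sum_subset hsub]
    · rw [Nat.cast_sum, mul_sum]
      refine sum_congr rfl fun b hb => ?_
      have hb := mem_Ico.1 hb
      obtain ⟨c, rfl⟩ := Nat.exists_eq_add_of_le' hb.1
      obtain ⟨e, rfl⟩ := Nat.exists_eq_add_of_le hb.2.le
      have h1 := ih (k := c + 1 + e + 1 - (c + 1)) (N := N - (c + 1)) (by omega) (by omega) (c + 1)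
      rw [layerCoeff, show c + 1 + e + 1 - (c + 1) = e + 1 by omega, choose_two_add c e,
        show c + 1 - 1 = c by omega, show c + 1 + e - (c + 1) = e by omega]
      rw [show c + 1 + e + 1 - (c + 1) = e + 1 by omega] at h1
      push_cast [Nat.one_le_two_pow]
      rw [h1]
      have h2 : (N.choose (c + 1) : ℝ) =
          N.factorial / ((c + 1).factorial * (N - (c + 1)).factorial) :=
        Nat.cast_choose ℝ (by omega)
      have h3 : ((c + 1 + e + 1).choose (c + 1) : ℝ) =
          (c + 1 + e + 1).factorial / ((c + 1).factorial * (e + 1).factorial) := by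
        rw [Nat.cast_choose ℝ (by omega), show c + 1 + e + 1 - (c + 1) = e + 1 by omega]
      rw [h2, h3, Nat.factorial_succ (c + 1 + e), one_div, inv_pow, pow_add, pow_add]
      have f1 : ((c + 1 + e).factorial : ℝ) ≠ 0 := by positivity
      have f2 : ((c + 1).factorial : ℝ) ≠ 0 := by positivity
      have f3 : ((N - (c + 1)).factorial : ℝ) ≠ 0 := by positivity
      have f4 : ((e + 1).factorial : ℝ) ≠ 0 := by positivity
      push_cast
      field_simp
      ring
    · intro b hb hb'
      have hb := mem_range.1 hb
      rw [mem_Ico, not_and_or] at hb'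
      rcases Nat.eq_zero_or_pos b with rfl | hb0
      · rw [layerCount_zero_right]; simp
      · rw [layerCount_eq_zero (by omega)]; simp

/-! ### Pairs at distance d and the upper bound -/

theorem exists_adj_of_edist_eq_succ {V : Type*} {G : SimpleGraph V} {u v : V} {j : ℕ}
    (h : G.edist u v = ((j + 1 : ℕ) : ℕ∞)) : ∃ a, G.edist u a = (j : ℕ∞) ∧ G.Adj a v := by
  rw [SimpleGraph.edist_comm] at h
  obtain ⟨p, hp⟩ := SimpleGraph.exists_walk_of_edist_eq_coe h
  cases p with
  | nil => simp at hp
  | cons hadj q =>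
    rename_i a
    refine ⟨a, ?_, hadj.symm⟩
    rw [SimpleGraph.Walk.length_cons, Nat.add_right_cancel_iff] at hp
    have h1 : G.edist a u ≤ j := hp ▸ SimpleGraph.edist_le q
    have h2 := G.edist_triangle (u := v) (v := a) (w := u)
    rw [h, SimpleGraph.edist_eq_one_iff_adj.2 hadj] at h2
    rw [SimpleGraph.edist_comm]
    obtain ⟨x, hx⟩ := ENat.ne_top_iff_exists.1 (ne_top_of_le_ne_top (ENat.natCast_ne_top j) h1)
    rw [← hx] at h1 h2 ⊢
    norm_cast at h1 h2 ⊢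
    omega

theorem exists_edist_eq_of_le {V : Type*} {G : SimpleGraph V} {u v : V} {j k : ℕ}
    (h : G.edist u v = (k : ℕ∞)) (hjk : j ≤ k) : ∃ w, G.edist u w = (j : ℕ∞) := by
  induction k generalizing v with
  | zero => exact ⟨v, by rw [h, Nat.le_zero.1 hjk]⟩
  | succ k ih =>
    rcases hjk.eq_or_lt with rfl | hlt
    · exact ⟨v, h⟩
    · obtain ⟨a, ha, -⟩ := exists_adj_of_edist_eq_succ h
      exact ih ha (by omega)

theorem exists_edist_eq_of_mem_graphsOfDiamAtLeast {n d : ℕ} {G : SimpleGraph (Fin n)}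
    (h : G ∈ graphsOfDiamAtLeast n d) : ∃ u w, G.edist u w = (d : ℕ∞) := by
  obtain ⟨hc, hd⟩ := h
  have := hc.nonempty
  obtain ⟨u, v, huv⟩ := G.exists_edist_eq_ediam_of_finite
  obtain ⟨p, hp⟩ := hc.exists_walk_length_eq_edist u v
  rw [← huv, ← hp] at hd
  obtain ⟨w, hw⟩ := exists_edist_eq_of_le hp.symm (by exact_mod_cast hd)
  exact ⟨u, w, hw⟩

/-- The search layers are the distance spheres around u. Unreachable vertices, at distance `⊤`, stay
in `R` throughout, so no connectedness is needed. -/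
theorem layerReach_of_edist_eq {V : Type*} [DecidableEq V] {G : SimpleGraph V} {u w : V}
    {t j : ℕ} {A R : Finset V} (hA : ∀ v, v ∈ A ↔ G.edist u v = (j : ℕ∞))
    (hR : ∀ v, v ∈ R ↔ (j : ℕ∞) < G.edist u v) (h : G.edist u w = ((j + t + 1 : ℕ) : ℕ∞)) :
    LayerReach G w t A R := by
  have hnext : ∀ v, v ∈ nextLayer G A R ↔ G.edist u v = ((j + 1 : ℕ) : ℕ∞) := by
    intro v
    rw [mem_nextLayer, hR]
    constructor
    · rintro ⟨h1, a, ha, hav⟩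
      have h2 := G.edist_triangle (u := u) (v := a) (w := v)
      rw [(hA a).1 ha, SimpleGraph.edist_eq_one_iff_adj.2 hav] at h2
      refine le_antisymm (by exact_mod_cast h2) ?_
      push_cast
      exact Order.add_one_le_of_lt h1
    · intro h1
      obtain ⟨a, ha, hav⟩ := exists_adj_of_edist_eq_succ h1
      refine ⟨?_, a, (hA a).2 ha, hav⟩
      rw [h1]; exact_mod_cast Nat.lt_succ_self j
  induction t generalizing j A R with
  | zero => exact (hnext w).2 h
  | succ t ih =>
    have hR' : ∀ v, v ∈ R \ nextLayer G A R ↔ ((j + 1 : ℕ) : ℕ∞) < G.edist u v := by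
      intro v
      rw [mem_sdiff, hR, hnext]
      constructor
      · rintro ⟨h1, h2⟩
        refine lt_of_le_of_ne ?_ (Ne.symm h2)
        push_cast
        exact Order.add_one_le_of_lt h1
      · intro h1
        refine ⟨lt_trans ?_ h1, h1.ne'⟩
        exact_mod_cast Nat.lt_succ_self j
    refine ih (j := j + 1) hnext hR' ?_ ?_
    · rw [h]; congr 1; omega
    · intro v
      rw [mem_nextLayer, hR']
      constructor
      · rintro ⟨h1, a, ha, hav⟩
        have h2 := G.edist_triangle (u := u) (v := a) (w := v)
        rw [(hnext a).1 ha, SimpleGraph.edist_eq_one_iff_adj.2 hav] at h2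
        refine le_antisymm (by exact_mod_cast h2) ?_
        push_cast at h1 ⊢
        exact Order.add_one_le_of_lt h1
      · intro h1
        obtain ⟨a, ha, hav⟩ := exists_adj_of_edist_eq_succ h1
        refine ⟨?_, a, (hnext a).2 ha, hav⟩
        rw [h1]; exact_mod_cast Nat.lt_succ_self (j + 1)

/-- The graphs on `n` labelled vertices with an ordered pair of vertices at distance `d`. -/
def graphsWithPair (n d : ℕ) : Set (SimpleGraph (Fin n) × Fin n × Fin n) :=
  {p | p.1.edist p.2.1 p.2.2 = (d : ℕ∞)}

theorem ncard_graphsWithPair_le (n t : ℕ) :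
    (graphsWithPair n (t + 1)).ncard ≤ n * layerCount t (n - 1) 1 := by
  have hsub : graphsWithPair n (t + 1) ⊆
      ⋃ u ∈ (univ : Finset (Fin n)), {p ∈ graphsWithPair n (t + 1) | p.2.1 = u} := by
    intro p hp
    simp only [Set.mem_iUnion]
    exact ⟨p.2.1, mem_univ _, hp, rfl⟩
  refine (Set.ncard_le_ncard hsub (Set.toFinite _)).trans ?_
  refine (Finset.set_ncard_biUnion_le _ _).trans ?_
  have hu : ∀ u ∈ (univ : Finset (Fin n)), {p ∈ graphsWithPair n (t + 1) | p.2.1 = u}.ncard ≤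
      layerCount t (n - 1) 1 := by
    intro u _
    have hle := ncard_layeredGraphs_le t {u} (univ \ {u})
    rw [card_singleton, card_sdiff_of_subset (subset_univ _), card_univ, Fintype.card_fin,
      card_singleton] at hle
    refine le_trans ?_ hle
    refine Set.ncard_le_ncard_of_injOn (fun p => (p.1, p.2.2)) ?_ ?_ (Set.toFinite _)
    · rintro ⟨G, u', w⟩ ⟨h, hu'⟩
      obtain rfl : u' = u := hu'
      have h : G.edist u' w = ((t + 1 : ℕ) : ℕ∞) := h
      refine ⟨fun x y hxy => ?_, ?_⟩
      · have := hxy.ne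
        simp only [layerEdge, mem_sdiff, mem_univ, mem_singleton, mem_union, true_and]
        by_cases hx : x = u'
        · exact Or.inr ⟨fun hy => this (hx.trans hy.symm), Or.inl hx⟩
        · exact Or.inl ⟨hx, em _⟩
      · refine layerReach_of_edist_eq (j := 0) (u := u') ?_ ?_ (by rw [h, zero_add])
        · intro v
          rw [mem_singleton, Nat.cast_zero, SimpleGraph.edist_eq_zero_iff, eq_comm]
        · intro v
          rw [mem_sdiff, mem_singleton, Nat.cast_zero, pos_iff_ne_zero, Ne,
            SimpleGraph.edist_eq_zero_iff, eq_comm]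
          simp
    · rintro ⟨G, u₁, w⟩ ⟨-, h₁⟩ ⟨G', u₂, w'⟩ ⟨-, h₂⟩ h
      simp only [Prod.mk.injEq] at h h₁ h₂ ⊢
      exact ⟨h.1, h₁.trans h₂.symm, h.2⟩
  refine (sum_le_card_nsmul _ _ _ hu).trans_eq ?_
  rw [card_univ, Fintype.card_fin, smul_eq_mul]

/-- A shortest path realising the diameter contains a vertex at distance exactly d from its start;
this pair can be taken in two orders, and the two are different because d ≥ 1. -/
theorem two_mul_ncard_graphsOfDiamAtLeast_le {n d : ℕ} (hd : 1 ≤ d) :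
    2 * (graphsOfDiamAtLeast n d).ncard ≤ (graphsWithPair n d).ncard := by
  choose u w huw using fun G : graphsOfDiamAtLeast n d =>
    exists_edist_eq_of_mem_graphsOfDiamAtLeast G.2
  have hne : ∀ G, u G ≠ w G := by
    intro G h
    have := huw G
    rw [h, SimpleGraph.edist_self] at this
    have : 0 = d := by exact_mod_cast this
    omega
  let f : Bool × graphsOfDiamAtLeast n d → graphsWithPair n d := fun p =>
    if p.1 then ⟨(p.2, u p.2, w p.2), huw p.2⟩
    else ⟨(p.2, w p.2, u p.2), by
      have := huw p.2
      rwa [SimpleGraph.edist_comm] at this⟩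
  have hf : Function.Injective f := by
    rintro ⟨b, G⟩ ⟨b', G'⟩ h
    have h' := congrArg Subtype.val h
    cases b <;> cases b' <;> simp only [f, if_true, if_false, Prod.mk.injEq,
      Bool.false_eq_true] at h'
    · exact Prod.ext rfl (Subtype.ext h'.1)
    · obtain rfl : G = G' := Subtype.ext h'.1
      exact absurd h'.2.2 (hne G)
    · obtain rfl : G = G' := Subtype.ext h'.1
      exact absurd h'.2.1 (hne G)
    · exact Prod.ext rfl (Subtype.ext h'.1)
  have := Nat.card_le_card_of_injective f hf
  rwa [Nat.card_prod, Nat.card_eq_fintype_card, Fintype.card_bool, Nat.card_coe_set_eq,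
    Nat.card_coe_set_eq] at this

theorem ncard_graphsOfDiamAtLeast_le {n d B : ℕ} (hn : 8 ≤ n) (hd : 3 ≤ d) (hdn : d < n)
    (hB : n ^ 8 ≤ 2 ^ B) (hm : 100 * B ≤ n - d + 1) :
    ((graphsOfDiamAtLeast n d).ncard : ℝ) ≤ (1 + 9 / n) * (((d : ℝ) - 2) / 2 *
      (n.descFactorial (d - 1) : ℝ) * (3 : ℝ) ^ (n - d + 1) *
        (2 : ℝ) ^ ((n - d + 1).choose 2)) := by
  obtain ⟨t, rfl⟩ := Nat.exists_eq_add_of_le' hd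
  set m := n - (t + 3) + 1 with hmdef
  have hn0 : (0 : ℝ) < n := by exact_mod_cast (by omega : 0 < n)
  have h1 := (two_mul_ncard_graphsOfDiamAtLeast_le (n := n) (d := t + 3) (by omega)).trans
    (ncard_graphsWithPair_le n (t + 2))
  have h2 : (2 : ℝ) * (graphsOfDiamAtLeast n (t + 3)).ncard ≤
      n * layerCount (t + 2) (n - 1) 1 := by exact_mod_cast h1
  rw [layerCount_eq (k := m) (by omega) (by omega)] at h2
  have h3 := layerWeight_one_le (n := n) (t := t + 1) (m := m) hn (by omega) (by omega) hB
    (by omega)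
  -- The n choices of u and the factorials of the normalisation combine to the falling factorial of
  -- length d - 1.
  have hfac : (n : ℝ) * ((n - 1).factorial / m.factorial) = n.descFactorial (t + 2) := by
    have e1 : (n : ℝ) * (n - 1).factorial = n.factorial := by
      exact_mod_cast Nat.mul_factorial_pred (by omega)
    have e2 : (m.factorial : ℝ) * n.descFactorial (t + 2) = n.factorial := by
      have := Nat.factorial_mul_descFactorial (show t + 2 ≤ n by omega)
      rw [show n - (t + 2) = m by omega] at this
      exact_mod_cast this
    rw [← mul_div_assoc, e1, ← e2]
    field_simp
  have h4 : (((t + 1 : ℕ) : ℝ) * (1 + 8 / n) + 1 / n) ≤ (t + 1) * (1 + 9 / n) := by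
    have e1 : (0 : ℝ) ≤ 1 / n := by positivity
    have e2 : (0 : ℝ) ≤ t * (1 / n) := by positivity
    have e3 : (8 / n : ℝ) = 8 * (1 / n) := by ring
    have e4 : (9 / n : ℝ) = 9 * (1 / n) := by ring
    rw [e3, e4]
    push_cast
    nlinarith
  have h5 : (n : ℝ) * ((n - 1).factorial / m.factorial * 2 ^ m.choose 2 *
      layerWeight (t + 2) m 1) ≤
      n.descFactorial (t + 2) * 2 ^ m.choose 2 * ((t + 1) * (1 + 9 / n) * 3 ^ m) := by
    calc _ = (n : ℝ) * ((n - 1).factorial / m.factorial) * 2 ^ m.choose 2 *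
          layerWeight (t + 2) m 1 := by ring
      _ ≤ _ := by
        rw [hfac]
        gcongr
        exact h3.trans (by gcongr)
  have h6 := h2.trans h5
  rw [show t + 3 - 1 = t + 2 by omega]
  push_cast
  calc ((graphsOfDiamAtLeast n (t + 3)).ncard : ℝ)
      ≤ ((n.descFactorial (t + 2) : ℝ) * 2 ^ m.choose 2 *
        (((t : ℝ) + 1) * (1 + 9 / n) * 3 ^ m)) / 2 := by linarith
    _ = _ := by ring

/-! ### Almost all coloured blocks are good -/

section block

variable {S : Type*}

/-- Every two vertices have a common neighbour in `H`, and every vertex has neighbours of every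
colour. -/
def goodBlocks (S : Type*) : Set ((S → Fin 3) × SimpleGraph S) :=
  {p | (∀ x y, x ≠ y → ∃ z, p.2.Adj z x ∧ p.2.Adj z y) ∧ ∀ t x, ∃ z, p.1 z = t ∧ p.2.Adj z x}

theorem card_colouredGraphs (S : Type*) [Fintype S] :
    Nat.card ((S → Fin 3) × SimpleGraph S) =
      3 ^ Fintype.card S * 2 ^ (Fintype.card S).choose 2 := by
  rw [Nat.card_prod, card_simpleGraph, Nat.card_fun, Nat.card_eq_fintype_card (α := Fin 3),
    Fintype.card_fin, Nat.card_eq_fintype_card]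

/-- Each of the other vertices has 3 of the 4 possible adjacencies to x and y; the factor 2 is the
pair xy itself. -/
theorem ncard_no_common_neighbour_le [Fintype S] {x y : S} (hxy : x ≠ y) :
    {p : (S → Fin 3) × SimpleGraph S | ∀ z, ¬ (p.2.Adj z x ∧ p.2.Adj z y)}.ncard ≤
      3 ^ Fintype.card S *
        (2 * 3 ^ (Fintype.card S - 2) * 2 ^ (Fintype.card S - 2).choose 2) := by
  classical
  let R : Finset S := univ \ {x, y}
  have hR : #R = Fintype.card S - 2 := by
    rw [card_sdiff_of_subset (subset_univ _), card_univ, card_pair hxy]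
  let T := (S → Fin 3) × Bool × (↥R → {q : Bool × Bool // ¬ (q.1 = true ∧ q.2 = true)}) ×
    SimpleGraph ↥R
  have h3 : Nat.card {q : Bool × Bool // ¬ (q.1 = true ∧ q.2 = true)} = 3 := by
    rw [Nat.card_eq_fintype_card]; rfl
  have hT : Nat.card T = 3 ^ Fintype.card S *
        (2 * 3 ^ (Fintype.card S - 2) * 2 ^ (Fintype.card S - 2).choose 2) := by
    simp only [T, Nat.card_prod, Nat.card_fun, h3, card_simpleGraph, Fintype.card_coe, hR,
      Nat.card_eq_finsetCard, Nat.card_eq_fintype_card (α := Bool), Fintype.card_bool,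
      Nat.card_eq_fintype_card (α := Fin 3), Fintype.card_fin, Nat.card_eq_fintype_card (α := S)]
    ring
  rw [← hT, ← Nat.card_coe_set_eq]
  let f : {p : (S → Fin 3) × SimpleGraph S | ∀ z, ¬ (p.2.Adj z x ∧ p.2.Adj z y)} → T := fun p =>
    (p.1.1, decide (p.1.2.Adj x y),
      fun z => ⟨(decide (p.1.2.Adj z x), decide (p.1.2.Adj z y)), by simpa using p.2 z⟩,
      p.1.2.induce R)
  refine Nat.card_le_card_of_injective f ?_
  rintro ⟨⟨c, H⟩, hp⟩ ⟨⟨c', H'⟩, hp'⟩ h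
  have h1 : c = c' := congrArg (fun q : T => q.1) h
  have h2 : decide (H.Adj x y) = decide (H'.Adj x y) := congrArg (fun q : T => q.2.1) h
  have h3 := congrArg (fun q : T => q.2.2.1) h
  have h4 : H.induce R = H'.induce R := congrArg (fun q : T => q.2.2.2) h
  have h2' : H.Adj x y ↔ H'.Adj x y := by simpa using h2
  have h3' : ∀ z ∈ R, (H.Adj z x ↔ H'.Adj z x) ∧ (H.Adj z y ↔ H'.Adj z y) := by
    intro z hz
    have : ((decide (H.Adj z x), decide (H.Adj z y)) : Bool × Bool) =
      (decide (H'.Adj z x), decide (H'.Adj z y)) := congrArg Subtype.val (congrFun h3 ⟨z, hz⟩)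
    simpa using this
  have h4' : ∀ z ∈ R, ∀ w ∈ R, H.Adj z w ↔ H'.Adj z w := by
    intro z hz w hw
    have := congrArg (fun G : SimpleGraph ↥R => G.Adj ⟨z, hz⟩ ⟨w, hw⟩) h4
    simpa using this
  have hmem : ∀ z, z ∈ R ↔ z ≠ x ∧ z ≠ y := by simp [R]
  have hH : H = H' := by
    ext z w
    by_cases hzx : z = x
    · subst hzx
      by_cases hwz : w = z
      · subst hwz; simp
      by_cases hwy : w = y
      · subst hwy; exact h2'
      rw [H.adj_comm, H'.adj_comm]
      exact (h3' w ((hmem w).2 ⟨hwz, hwy⟩)).1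
    by_cases hzy : z = y
    · subst hzy
      by_cases hwz : w = z
      · subst hwz; simp
      rw [H.adj_comm, H'.adj_comm]
      by_cases hwx : w = x
      · subst hwx; exact h2'
      exact (h3' w ((hmem w).2 ⟨hwx, hwz⟩)).2
    have hz := (hmem z).2 ⟨hzx, hzy⟩
    by_cases hwx : w = x
    · subst hwx; exact (h3' z hz).1
    by_cases hwy : w = y
    · subst hwy; exact (h3' z hz).2
    exact h4' z hz w ((hmem w).2 ⟨hwx, hwy⟩)
  subst h1 hH
  rfl

/-- Each other vertex z has 5 of the 6 combinations of a colour and an adjacency to x; the factor 3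
is the colour of x. -/
theorem ncard_no_coloured_neighbour_le [Fintype S] (t : Fin 3) (x : S) :
    {p : (S → Fin 3) × SimpleGraph S | ∀ z, ¬ (p.1 z = t ∧ p.2.Adj z x)}.ncard ≤
      3 * 5 ^ (Fintype.card S - 1) * 2 ^ (Fintype.card S - 1).choose 2 := by
  classical
  let R : Finset S := univ.erase x
  have hR : #R = Fintype.card S - 1 := by
    rw [card_erase_of_mem (mem_univ _), card_univ]
  let T := Fin 3 × (↥R → {q : Fin 3 × Bool // ¬ (q.1 = t ∧ q.2 = true)}) × SimpleGraph ↥R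
  have h5 : Nat.card {q : Fin 3 × Bool // ¬ (q.1 = t ∧ q.2 = true)} = 5 := by
    rw [Nat.card_eq_fintype_card]
    revert t
    decide
  have hT : Nat.card T =
      3 * 5 ^ (Fintype.card S - 1) * 2 ^ (Fintype.card S - 1).choose 2 := by
    simp only [T, Nat.card_prod, Nat.card_fun, h5, card_simpleGraph, Fintype.card_coe, hR,
      Nat.card_eq_finsetCard, Nat.card_eq_fintype_card (α := Fin 3), Fintype.card_fin]
    ring
  rw [← hT, ← Nat.card_coe_set_eq]
  let f : {p : (S → Fin 3) × SimpleGraph S | ∀ z, ¬ (p.1 z = t ∧ p.2.Adj z x)} → T := fun p =>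
    (p.1.1 x, fun z => ⟨(p.1.1 z, decide (p.1.2.Adj z x)), by simpa using p.2 z⟩,
      p.1.2.induce R)
  refine Nat.card_le_card_of_injective f ?_
  rintro ⟨⟨c, H⟩, hp⟩ ⟨⟨c', H'⟩, hp'⟩ h
  have h1 : c x = c' x := congrArg (fun q : T => q.1) h
  have h3 := congrArg (fun q : T => q.2.1) h
  have h4 : H.induce R = H'.induce R := congrArg (fun q : T => q.2.2) h
  have h3' : ∀ z ∈ R, c z = c' z ∧ (H.Adj z x ↔ H'.Adj z x) := by
    intro z hz
    have : ((c z, decide (H.Adj z x)) : Fin 3 × Bool) = (c' z, decide (H'.Adj z x)) :=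
      congrArg Subtype.val (congrFun h3 ⟨z, hz⟩)
    simpa using this
  have h4' : ∀ z ∈ R, ∀ w ∈ R, H.Adj z w ↔ H'.Adj z w := by
    intro z hz w hw
    have := congrArg (fun G : SimpleGraph ↥R => G.Adj ⟨z, hz⟩ ⟨w, hw⟩) h4
    simpa using this
  have hmem : ∀ z, z ∈ R ↔ z ≠ x := by simp [R]
  have hc : c = c' := by
    ext1 z
    by_cases hz : z = x
    · rw [hz, h1]
    · exact (h3' z ((hmem z).2 hz)).1
  have hH : H = H' := by
    ext z w
    by_cases hzx : z = x
    · subst hzx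
      by_cases hwz : w = z
      · subst hwz; simp
      rw [H.adj_comm, H'.adj_comm]
      exact (h3' w ((hmem w).2 hwz)).2
    have hz := (hmem z).2 hzx
    by_cases hwx : w = x
    · subst hwx; exact (h3' z hz).2
    exact h4' z hz w ((hmem w).2 hwx)
  subst hc hH
  rfl

/-- Union bound over pairs of vertices, each failing with probability (3/4)^(m-2), and over colours
and vertices, each failing with probability (5/6)^(m-1). -/
theorem le_ncard_goodBlocks [Fintype S] (hS : 2 ≤ Fintype.card S) :
    (1 - ((Fintype.card S : ℝ) ^ 2 * (3 / 4) ^ (Fintype.card S - 2) +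
      3 * Fintype.card S * (5 / 6) ^ (Fintype.card S - 1))) *
      (3 ^ Fintype.card S * 2 ^ (Fintype.card S).choose 2) ≤ (goodBlocks S).ncard := by
  classical
  set m := Fintype.card S with hm
  let E : S × S → Set ((S → Fin 3) × SimpleGraph S) := fun q =>
    {p | ∀ z, ¬ (p.2.Adj z q.1 ∧ p.2.Adj z q.2)}
  let F : Fin 3 × S → Set ((S → Fin 3) × SimpleGraph S) := fun q =>
    {p | ∀ z, ¬ (p.1 z = q.1 ∧ p.2.Adj z q.2)}
  have hcov : (Set.univ : Set ((S → Fin 3) × SimpleGraph S)) ⊆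
      goodBlocks S ∪ ((⋃ q ∈ (univ : Finset (S × S)).filter (fun q => q.1 ≠ q.2), E q) ∪
        ⋃ q ∈ (univ : Finset (Fin 3 × S)), F q) := by
    intro p _
    by_contra h
    simp only [Set.mem_union, Set.mem_iUnion, not_or, not_exists] at h
    obtain ⟨h1, h2, h3⟩ := h
    refine h1 ⟨fun x y hxy => ?_, fun t x => ?_⟩
    · have := h2 (x, y) (by simpa using hxy)
      by_contra h'
      exact this (fun z hz => h' ⟨z, hz⟩)
    · have := h3 (t, x) (mem_univ _)
      by_contra h'
      exact this (fun z hz => h' ⟨z, hz⟩)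
  have hle := (Set.ncard_le_ncard hcov (Set.toFinite _)).trans ((Set.ncard_union_le _ _).trans
    (Nat.add_le_add_left (Set.ncard_union_le _ _) _))
  rw [Set.ncard_univ, card_colouredGraphs, ← hm] at hle
  have hE := ((univ : Finset (S × S)).filter (fun q => q.1 ≠ q.2)).set_ncard_biUnion_le E
  have hF := (univ : Finset (Fin 3 × S)).set_ncard_biUnion_le F
  have hE' := hE.trans (sum_le_card_nsmul _ _ _ fun q hq =>
    ncard_no_common_neighbour_le (mem_filter.1 hq).2)
  have hF' := hF.trans (sum_le_card_nsmul _ _ _ fun q _ => ncard_no_coloured_neighbour_le q.1 q.2)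
  rw [card_univ, Fintype.card_prod, Fintype.card_fin, smul_eq_mul, ← hm] at hF'
  have hcard : #((univ : Finset (S × S)).filter (fun q => q.1 ≠ q.2)) ≤ m ^ 2 := by
    refine (card_filter_le _ _).trans_eq ?_
    rw [card_univ, Fintype.card_prod, ← hm, sq]
  rw [smul_eq_mul, ← hm] at hE'
  have hE'' := hE'.trans (Nat.mul_le_mul_right _ hcard)
  obtain ⟨j, hj⟩ := Nat.exists_eq_add_of_le' hS
  have c0 : ∀ i : ℕ, (i + 1).choose 2 = i.choose 2 + i := by
    intro i
    have : (i + 1).choose 2 = i.choose 1 + i.choose 2 := Nat.choose_succ_succ' i 1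
    rw [this, Nat.choose_one_right, add_comm]
  have c1 := c0 j
  have c2 : (j + 2).choose 2 = j.choose 2 + j + (j + 1) := by rw [c0 (j + 1), c1]
  have hle' : (3 ^ m * 2 ^ m.choose 2 : ℝ) ≤ (goodBlocks S).ncard +
      ((m : ℝ) ^ 2 * (3 ^ m * (2 * 3 ^ (m - 2) * 2 ^ (m - 2).choose 2)) +
        3 * m * (3 * 5 ^ (m - 1) * 2 ^ (m - 1).choose 2)) := by
    exact_mod_cast hle.trans (Nat.add_le_add_left (Nat.add_le_add hE'' hF') _)
  have e1 : (3 ^ m * (2 * 3 ^ (m - 2) * 2 ^ (m - 2).choose 2) : ℝ) =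
      (3 / 4) ^ (m - 2) * (3 ^ m * 2 ^ m.choose 2) := by
    rw [hj, Nat.add_sub_cancel, c2, div_pow, show (4 : ℝ) = 2 * 2 by norm_num, mul_pow,
      pow_add (2 : ℝ), pow_add (2 : ℝ), pow_succ (2 : ℝ)]
    field_simp
  have e2 : (3 * 5 ^ (m - 1) * 2 ^ (m - 1).choose 2 : ℝ) =
      (5 / 6) ^ (m - 1) * (3 ^ m * 2 ^ m.choose 2) := by
    rw [hj, show j + 2 - 1 = j + 1 by omega, c2, c1, div_pow, show (6 : ℝ) = 3 * 2 by norm_num,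
      mul_pow, pow_add (2 : ℝ) _ (j + 1), pow_succ (3 : ℝ) (j + 1)]
    field_simp
  rw [e1, e2] at hle'
  linarith

end block

/-! ### Distances in a block plus a path -/

theorem le_add_edist_of_adj {V : Type*} {G : SimpleGraph V} {l : V → ℕ}
    (hl : ∀ x y, G.Adj x y → l y ≤ l x + 1) (x y : V) : (l y : ℕ∞) ≤ l x + G.edist x y := by
  rcases eq_or_ne (G.edist x y) ⊤ with h | h
  · rw [h, add_top]; exact le_top
  · obtain ⟨p, hp⟩ := SimpleGraph.exists_walk_of_edist_ne_top h
    rw [← hp]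
    clear hp h
    induction p with
    | nil => simp
    | cons hadj q ih =>
      refine ih.trans ?_
      rw [SimpleGraph.Walk.length_cons]
      have := hl _ _ hadj
      norm_cast
      omega

theorem edist_le_two_of_adj {V : Type*} {G : SimpleGraph V} {x y z : V} (h1 : G.Adj x z)
    (h2 : G.Adj z y) : G.edist x y ≤ 2 :=
  SimpleGraph.edist_le (h1.toWalk.append h2.toWalk)

theorem edist_le_sub_of_adj {V : Type*} {G : SimpleGraph V} {v : ℕ → V} {j k : ℕ} (hjk : j ≤ k)
    (h : ∀ l, j ≤ l → l < k → G.Adj (v l) (v (l + 1))) : G.edist (v j) (v k) ≤ (k - j : ℕ) := by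
  induction k, hjk using Nat.le_induction with
  | base => simp
  | succ k hjk ih =>
    refine (G.edist_triangle (v := v k)).trans ?_
    rw [SimpleGraph.edist_eq_one_iff_adj.2 (h k hjk (Nat.lt_succ_self k)),
      show k + 1 - j = k - j + 1 by omega, Nat.cast_add, Nat.cast_one]
    gcongr
    exact ih fun l h1 h2 => h l h1 (by omega)

/-- Stated for a map into an arbitrary graph, since it serves both the whole graph and the block on
S ∪ {a, b}. A vertex of S has neighbours of colours 0 and 1, hence is within 2 of both a and b. -/
theorem edist_le_of_mem_goodBlocks {S W : Type*} {c : S → Fin 3} {H : SimpleGraph S}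
    (h : (c, H) ∈ goodBlocks S) {K : SimpleGraph W} (φ : S → W) (a b : W)
    (hφ : ∀ s t, H.Adj s t → K.Adj (φ s) (φ t)) (ha : ∀ s, c s = 0 → K.Adj a (φ s))
    (hb : ∀ s, c s = 1 → K.Adj b (φ s)) :
    (∀ s t, K.edist (φ s) (φ t) ≤ 2) ∧ (∀ s, K.edist a (φ s) ≤ 2) ∧
      (∀ s, K.edist b (φ s) ≤ 2) ∧ (Nonempty S → K.edist a b ≤ 3) := by
  have h2 : ∀ s, K.edist a (φ s) ≤ 2 := by
    intro s
    obtain ⟨z, hz, hzs⟩ := h.2 0 s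
    exact edist_le_two_of_adj (ha z hz) (hφ z s hzs)
  refine ⟨fun s t => ?_, h2, fun s => ?_, fun ⟨s⟩ => ?_⟩
  · by_cases hst : s = t
    · rw [hst, SimpleGraph.edist_self]; exact zero_le
    · obtain ⟨z, hzs, hzt⟩ := h.1 s t hst
      exact edist_le_two_of_adj (hφ z s hzs).symm (hφ z t hzt)
  · obtain ⟨z, hz, hzs⟩ := h.2 1 s
    exact edist_le_two_of_adj (hb z hz) (hφ z s hzs)
  · obtain ⟨z, hz, -⟩ := h.2 1 s
    calc K.edist a b ≤ K.edist a (φ z) + K.edist (φ z) b := SimpleGraph.edist_triangle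
      _ ≤ 2 + 1 := by
        gcongr
        · exact h2 z
        · rw [SimpleGraph.edist_eq_one_iff_adj.2 (hb z hz).symm]
      _ = 3 := by norm_num

section block

variable {V : Type*}

/-- The graph `H` on `S` with two more vertices `a` and `b`, adjacent to the vertices of `S` of
colour `0` and `1`, respectively. -/
def spineBlock (S : Set V) (a b : V) (c : ↥S → Fin 3) (H : SimpleGraph ↥S) : SimpleGraph V :=
  SimpleGraph.fromRel fun x y => (∃ (hx : x ∈ S) (hy : y ∈ S), H.Adj ⟨x, hx⟩ ⟨y, hy⟩) ∨
    (x = a ∧ ∃ hy : y ∈ S, c ⟨y, hy⟩ = 0) ∨ (x = b ∧ ∃ hy : y ∈ S, c ⟨y, hy⟩ = 1)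

/-- Two paths joined by a block. -/
def pathBlockGraph (d i : ℕ) (v : ℕ → V) (S : Set V) (c : ↥S → Fin 3) (H : SimpleGraph ↥S) :
    SimpleGraph V :=
  twoPaths d i v ⊔ spineBlock S (v (i - 1)) (v (i + 2)) c H

/-- The conditions under which `pathBlockGraph` has diameter `d`. -/
structure IsPathBlock (d i : ℕ) (v : ℕ → V) (S : Set V) (c : ↥S → Fin 3) (H : SimpleGraph ↥S) :
    Prop where
  one_le : 1 ≤ i
  add_two_le : i + 2 ≤ d
  injOn : Set.InjOn v (pathIndices d i)
  eq_compl : S = (v '' pathIndices d i)ᶜ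
  nonempty : S.Nonempty
  good : (c, H) ∈ goodBlocks S

open Classical in
/-- The distance from `v 0` in `pathBlockGraph d i v S c H`. -/
noncomputable def blockLevel (d i : ℕ) (v : ℕ → V) (S : Set V) (c : ↥S → Fin 3) (x : V) : ℕ :=
  if hx : x ∈ S then (if c ⟨x, hx⟩ = 0 then i else i + 1)
  else if h : ∃ j, j ∈ pathIndices d i ∧ v j = x then h.choose else 0

namespace IsPathBlock

variable {d i : ℕ} {v : ℕ → V} {S : Set V} {c : ↥S → Fin 3} {H : SimpleGraph ↥S}
  (h : IsPathBlock d i v S c H)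
include h

theorem notMem {j : ℕ} (hj : j ∈ pathIndices d i) : v j ∉ S := by
  rw [h.eq_compl]
  exact fun h' => h' ⟨j, hj, rfl⟩

theorem mem_or (x : V) : x ∈ S ∨ ∃ j ∈ pathIndices d i, x = v j := by
  by_cases hx : x ∈ S
  · exact Or.inl hx
  · rw [h.eq_compl, Set.notMem_compl_iff] at hx
    obtain ⟨j, hj, rfl⟩ := hx
    exact Or.inr ⟨j, hj, rfl⟩

theorem left_mem : i - 1 ∈ pathIndices d i := Or.inl (by have := h.one_le; omega)

theorem right_mem : i + 2 ∈ pathIndices d i := Or.inr ⟨le_rfl, h.add_two_le⟩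

theorem zero_mem : 0 ∈ pathIndices d i := Or.inl h.one_le

theorem last_mem : d ∈ pathIndices d i := Or.inr ⟨h.add_two_le, le_rfl⟩

theorem v_eq_iff {j k : ℕ} (hj : j ∈ pathIndices d i) (hk : k ∈ pathIndices d i) :
    v j = v k ↔ j = k :=
  ⟨fun h' => h.injOn hj hk h', fun h' => h' ▸ rfl⟩

theorem spineBlock_adj_mem {x y : V} (hx : x ∈ S) (hy : y ∈ S) :
    (spineBlock S (v (i - 1)) (v (i + 2)) c H).Adj x y ↔ H.Adj ⟨x, hx⟩ ⟨y, hy⟩ := by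
  have ha : ∀ z ∈ S, z ≠ v (i - 1) := fun z hz h' => h.notMem h.left_mem (h' ▸ hz)
  have hb : ∀ z ∈ S, z ≠ v (i + 2) := fun z hz h' => h.notMem h.right_mem (h' ▸ hz)
  simp only [spineBlock, SimpleGraph.fromRel_adj, ha x hx, hb x hx, ha y hy, hb y hy, false_and,
    or_false, hx, hy, exists_true_left]
  constructor
  · rintro ⟨-, h1 | h1⟩
    exacts [h1, h1.symm]
  · intro h1
    exact ⟨fun h' => h1.ne (Subtype.ext h'), Or.inl h1⟩

theorem spineBlock_adj_left {x : V} (hx : x ∈ S) :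
    (spineBlock S (v (i - 1)) (v (i + 2)) c H).Adj (v (i - 1)) x ↔ c ⟨x, hx⟩ = 0 := by
  have ha : x ≠ v (i - 1) := fun h' => h.notMem h.left_mem (h' ▸ hx)
  have hb : x ≠ v (i + 2) := fun h' => h.notMem h.right_mem (h' ▸ hx)
  have hab : v (i - 1) ≠ v (i + 2) := fun h' => by
    have := h.injOn h.left_mem h.right_mem h'
    omega
  simp [spineBlock, ha, hb, hab, ha.symm, hx, h.notMem h.left_mem]

theorem spineBlock_adj_right {x : V} (hx : x ∈ S) :
    (spineBlock S (v (i - 1)) (v (i + 2)) c H).Adj (v (i + 2)) x ↔ c ⟨x, hx⟩ = 1 := by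
  have ha : x ≠ v (i - 1) := fun h' => h.notMem h.left_mem (h' ▸ hx)
  have hb : x ≠ v (i + 2) := fun h' => h.notMem h.right_mem (h' ▸ hx)
  have hab : v (i + 2) ≠ v (i - 1) := fun h' => by
    have := h.injOn h.right_mem h.left_mem h'
    omega
  simp [spineBlock, ha, hb, hab, hb.symm, hx, h.notMem h.right_mem]

omit h in
theorem spineBlock_not_adj {x y : V} (hx : x ∉ S) (hy : y ∉ S) :
    ¬ (spineBlock S (v (i - 1)) (v (i + 2)) c H).Adj x y := by
  simp [spineBlock, hx, hy]

omit h in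
theorem eq_left_or_right {x y : V} (hx : x ∉ S)
    (hxy : (spineBlock S (v (i - 1)) (v (i + 2)) c H).Adj x y) :
    x = v (i - 1) ∨ x = v (i + 2) := by
  simp only [spineBlock, SimpleGraph.fromRel_adj, hx, IsEmpty.exists_iff, and_false,
    false_or, or_false] at hxy
  tauto

theorem twoPaths_not_adj {x y : V} (hx : x ∈ S) : ¬ (twoPaths d i v).Adj x y := by
  simp only [twoPaths, SimpleGraph.fromRel_adj]
  rintro ⟨-, ⟨j, hj, hj', rfl, rfl⟩ | ⟨j, hj, hj', rfl, rfl⟩⟩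
  · exact h.notMem hj hx
  · exact h.notMem hj' hx

theorem twoPaths_adj {j k : ℕ} (hj : j ∈ pathIndices d i) (hk : k ∈ pathIndices d i) :
    (twoPaths d i v).Adj (v j) (v k) ↔ k = j + 1 ∨ j = k + 1 := by
  simp only [twoPaths, SimpleGraph.fromRel_adj]
  constructor
  · rintro ⟨-, ⟨l, hl, hl', h1, h2⟩ | ⟨l, hl, hl', h1, h2⟩⟩
    · rw [h.v_eq_iff hj hl] at h1
      rw [h.v_eq_iff hk hl'] at h2
      exact Or.inl (h1 ▸ h2)
    · rw [h.v_eq_iff hk hl] at h1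
      rw [h.v_eq_iff hj hl'] at h2
      exact Or.inr (h1 ▸ h2)
  · rintro (rfl | rfl)
    · refine ⟨fun h' => ?_, Or.inl ⟨j, hj, hk, rfl, rfl⟩⟩
      rw [h.v_eq_iff hj hk] at h'; omega
    · refine ⟨fun h' => ?_, Or.inr ⟨k, hk, hj, rfl, rfl⟩⟩
      rw [h.v_eq_iff hj hk] at h'; omega

theorem adj_mem {x y : V} (hx : x ∈ S) (hy : y ∈ S) :
    (pathBlockGraph d i v S c H).Adj x y ↔ H.Adj ⟨x, hx⟩ ⟨y, hy⟩ := by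
  rw [pathBlockGraph, SimpleGraph.sup_adj, h.spineBlock_adj_mem hx hy]
  exact or_iff_right (h.twoPaths_not_adj hx)

theorem adj_left {x : V} (hx : x ∈ S) :
    (pathBlockGraph d i v S c H).Adj (v (i - 1)) x ↔ c ⟨x, hx⟩ = 0 := by
  rw [pathBlockGraph, SimpleGraph.sup_adj, h.spineBlock_adj_left hx]
  exact or_iff_right fun h' => h.twoPaths_not_adj hx h'.symm

theorem adj_right {x : V} (hx : x ∈ S) :
    (pathBlockGraph d i v S c H).Adj (v (i + 2)) x ↔ c ⟨x, hx⟩ = 1 := by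
  rw [pathBlockGraph, SimpleGraph.sup_adj, h.spineBlock_adj_right hx]
  exact or_iff_right fun h' => h.twoPaths_not_adj hx h'.symm

theorem adj_path {j k : ℕ} (hj : j ∈ pathIndices d i) (hk : k ∈ pathIndices d i) :
    (pathBlockGraph d i v S c H).Adj (v j) (v k) ↔ k = j + 1 ∨ j = k + 1 := by
  rw [pathBlockGraph, SimpleGraph.sup_adj, h.twoPaths_adj hj hk]
  exact or_iff_left (spineBlock_not_adj (h.notMem hj) (h.notMem hk))

theorem adj_path_mem {j : ℕ} {x : V} (hj : j ∈ pathIndices d i) (hx : x ∈ S)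
    (hjx : (pathBlockGraph d i v S c H).Adj (v j) x) :
    (j = i - 1 ∧ c ⟨x, hx⟩ = 0) ∨ (j = i + 2 ∧ c ⟨x, hx⟩ = 1) := by
  rcases (SimpleGraph.sup_adj _ _ _ _).1 hjx with h' | h'
  · exact absurd h'.symm (h.twoPaths_not_adj hx)
  · rcases eq_left_or_right (h.notMem hj) h' with h1 | h1
    · rw [h1, h.spineBlock_adj_left hx] at h'
      exact Or.inl ⟨(h.v_eq_iff hj h.left_mem).1 h1, h'⟩
    · rw [h1, h.spineBlock_adj_right hx] at h'
      exact Or.inr ⟨(h.v_eq_iff hj h.right_mem).1 h1, h'⟩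

theorem level_path {j : ℕ} (hj : j ∈ pathIndices d i) : blockLevel d i v S c (v j) = j := by
  have hex : ∃ k, k ∈ pathIndices d i ∧ v k = v j := ⟨j, hj, rfl⟩
  rw [blockLevel, dif_neg (h.notMem hj), dif_pos hex]
  exact h.injOn hex.choose_spec.1 hj hex.choose_spec.2

omit h in
theorem level_mem {x : V} (hx : x ∈ S) :
    blockLevel d i v S c x = if c ⟨x, hx⟩ = 0 then i else i + 1 := by
  rw [blockLevel, dif_pos hx]

theorem level_le_succ {x y : V} (hxy : (pathBlockGraph d i v S c H).Adj x y) :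
    blockLevel d i v S c y ≤ blockLevel d i v S c x + 1 := by
  have h1 := h.one_le
  rcases h.mem_or x with hx | ⟨j, hj, rfl⟩ <;> rcases h.mem_or y with hy | ⟨k, hk, rfl⟩
  · rw [level_mem hx, level_mem hy]
    split_ifs <;> omega
  · rw [level_mem hx, h.level_path hk]
    rcases h.adj_path_mem hk hx hxy.symm with ⟨rfl, h2⟩ | ⟨rfl, h2⟩ <;> rw [h2]
    · simp; omega
    · simp
  · rw [h.level_path hj, level_mem hy]
    rcases h.adj_path_mem hj hy hxy with ⟨rfl, h2⟩ | ⟨rfl, h2⟩ <;> rw [h2]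
    · simp; omega
    · simp
  · rw [h.level_path hj, h.level_path hk]
    have := (h.adj_path hj hk).1 hxy
    omega

theorem eq_of_level_eq {x : V} {j : ℕ} (hj : j ∈ pathIndices d i)
    (hx : blockLevel d i v S c x = j) : x = v j := by
  rcases h.mem_or x with hxS | ⟨k, hk, rfl⟩
  · rw [level_mem hxS] at hx
    have : j = i ∨ j = i + 1 := by split_ifs at hx <;> omega
    rcases hj with h1 | h1 <;> omega
  · rw [h.level_path hk] at hx
    rw [hx]

/-- Levels below i are single path vertices, so this makes i recognisable as the first level with
more than one vertex. -/
theorem exists_two_level : ∃ x y, x ≠ y ∧ blockLevel d i v S c x = i ∧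
    blockLevel d i v S c y = i := by
  obtain ⟨x₀, hx₀⟩ := h.nonempty
  obtain ⟨x, hx, -⟩ := h.good.2 0 ⟨x₀, hx₀⟩
  obtain ⟨y, hy, hxy⟩ := h.good.2 0 x
  dsimp only at hx hy hxy
  refine ⟨x, y, fun h' => hxy.ne (Subtype.ext h'.symm), ?_, ?_⟩
  · rw [level_mem x.2, if_pos hx]
  · rw [level_mem y.2, if_pos hy]

theorem edist_path {j k : ℕ} (hj : j ∈ pathIndices d i) (hk : k ∈ pathIndices d i)
    (hjk : j ≤ k) : (pathBlockGraph d i v S c H).edist (v j) (v k) ≤ (k - j : ℕ) := by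
  have arm : ∀ {j k : ℕ}, j ≤ k → (∀ l, j ≤ l → l ≤ k → l ∈ pathIndices d i) →
      (pathBlockGraph d i v S c H).edist (v j) (v k) ≤ (k - j : ℕ) := fun {j k} hjk hl =>
    edist_le_sub_of_adj hjk fun l h1 h2 =>
      (h.adj_path (hl l h1 h2.le) (hl (l + 1) (by omega) h2)).2 (Or.inl rfl)
  by_cases hk' : k < i
  · exact arm hjk fun l _ h2 => Or.inl (by omega)
  have hk2 : i + 2 ≤ k ∧ k ≤ d := by rcases hk with hk | hk <;> omega
  by_cases hj' : i + 2 ≤ j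
  · exact arm hjk fun l h1 h2 => Or.inr (by omega)
  have hj2 : j < i := by rcases hj with hj | hj <;> omega
  have h1 := arm (j := j) (k := i - 1) (by omega) fun l _ h2 => Or.inl (by omega)
  have h2 := arm (j := i + 2) (k := k) hk2.1 fun l h1 h2 => Or.inr (by omega)
  have h3 := (edist_le_of_mem_goodBlocks h.good (K := pathBlockGraph d i v S c H) Subtype.val
    (v (i - 1)) (v (i + 2)) (fun s t hst => (h.adj_mem s.2 t.2).2 hst)
    (fun s hs => (h.adj_left s.2).2 hs) (fun s hs => (h.adj_right s.2).2 hs)).2.2.2 h.nonempty.to_subtype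
  calc _ ≤ _ := SimpleGraph.edist_triangle (v := v (i - 1))
    _ ≤ ((i - 1 - j : ℕ) : ℕ∞) + (((3 : ℕ) : ℕ∞) + ((k - (i + 2) : ℕ) : ℕ∞)) := by
      gcongr
      exact (SimpleGraph.edist_triangle (v := v (i + 2))).trans (by gcongr; exact h3)
    _ = _ := by
      norm_cast
      omega

theorem edist_mem :
    (∀ x ∈ S, ∀ y ∈ S, (pathBlockGraph d i v S c H).edist x y ≤ 2) ∧
    (∀ x ∈ S, (pathBlockGraph d i v S c H).edist (v (i - 1)) x ≤ 2) ∧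
    (∀ x ∈ S, (pathBlockGraph d i v S c H).edist (v (i + 2)) x ≤ 2) := by
  obtain ⟨h1, h2, h3, -⟩ := edist_le_of_mem_goodBlocks h.good
    (K := pathBlockGraph d i v S c H) Subtype.val
    (v (i - 1)) (v (i + 2)) (fun s t hst => (h.adj_mem s.2 t.2).2 hst)
    (fun s hs => (h.adj_left s.2).2 hs) (fun s hs => (h.adj_right s.2).2 hs)
  exact ⟨fun x hx y hy => h1 ⟨x, hx⟩ ⟨y, hy⟩, fun x hx => h2 ⟨x, hx⟩, fun x hx => h3 ⟨x, hx⟩⟩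

theorem edist_path_mem {j : ℕ} (hj : j ∈ pathIndices d i) {x : V} (hx : x ∈ S) :
    (pathBlockGraph d i v S c H).edist (v j) x ≤ (d - 1 : ℕ) := by
  obtain ⟨-, h2, h3⟩ := h.edist_mem
  have hid := h.add_two_le
  have hi := h.one_le
  rcases hj with hj | hj
  · calc _ ≤ _ := SimpleGraph.edist_triangle (v := v (i - 1))
      _ ≤ ((i - 1 - j : ℕ) : ℕ∞) + ((2 : ℕ) : ℕ∞) := by
        gcongr
        · exact h.edist_path (Or.inl hj) h.left_mem (by omega)
        · exact h2 x hx
      _ ≤ _ := by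
        norm_cast
        omega
  · calc _ ≤ _ := SimpleGraph.edist_triangle (v := v (i + 2))
      _ ≤ ((j - (i + 2) : ℕ) : ℕ∞) + ((2 : ℕ) : ℕ∞) := by
        gcongr
        · rw [SimpleGraph.edist_comm]
          exact h.edist_path h.right_mem (Or.inr hj) (by omega)
        · exact h3 x hx
      _ ≤ _ := by
        norm_cast
        omega

theorem edist_zero (x : V) :
    (pathBlockGraph d i v S c H).edist (v 0) x = (blockLevel d i v S c x : ℕ∞) := by
  refine le_antisymm ?_ ?_
  · rcases h.mem_or x with hx | ⟨j, hj, rfl⟩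
    · have hi := h.one_le
      have h1 := h.edist_path h.zero_mem h.left_mem (Nat.zero_le _)
      have h2 := h.edist_mem.2.1 x hx
      rw [level_mem hx]
      split_ifs with hc
      · calc _ ≤ _ := SimpleGraph.edist_triangle (v := v (i - 1))
          _ ≤ ((i - 1 - 0 : ℕ) : ℕ∞) + ((1 : ℕ) : ℕ∞) := by
            gcongr
            rw [SimpleGraph.edist_eq_one_iff_adj.2 ((h.adj_left hx).2 hc)]
            exact le_rfl
          _ = _ := by
            norm_cast
            omega
      · calc _ ≤ _ := SimpleGraph.edist_triangle (v := v (i - 1))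
          _ ≤ ((i - 1 - 0 : ℕ) : ℕ∞) + ((2 : ℕ) : ℕ∞) := by
            gcongr
            exact h2
          _ = _ := by
            norm_cast
            omega
    · rw [h.level_path hj]
      exact h.edist_path h.zero_mem hj (Nat.zero_le _)
  · have := le_add_edist_of_adj (fun x y => h.level_le_succ) (v 0) x
    rwa [h.level_path h.zero_mem, Nat.cast_zero, zero_add] at this

theorem edist_zero_last : (pathBlockGraph d i v S c H).edist (v 0) (v d) = (d : ℕ∞) := by
  rw [h.edist_zero, h.level_path h.last_mem]

/-- Strict inequality away from the two ends makes the pair at distance d unique, which is what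
limits each graph to two descriptions. -/
theorem edist_le_or (x y : V) : (pathBlockGraph d i v S c H).edist x y ≤ (d - 1 : ℕ) ∨
    (x = v 0 ∧ y = v d) ∨ (x = v d ∧ y = v 0) := by
  have hid := h.add_two_le
  have hi := h.one_le
  have hle : ∀ j ∈ pathIndices d i, j ≤ d := fun j hj => by
    rcases hj with hj | hj <;> omega
  rcases h.mem_or x with hx | ⟨j, hj, rfl⟩ <;> rcases h.mem_or y with hy | ⟨k, hk, rfl⟩
  · refine Or.inl ((h.edist_mem.1 x hx y hy).trans ?_)
    exact_mod_cast (by omega : 2 ≤ d - 1)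
  · rw [SimpleGraph.edist_comm]
    exact Or.inl (h.edist_path_mem hk hx)
  · exact Or.inl (h.edist_path_mem hj hy)
  · have key : ∀ j ∈ pathIndices d i, ∀ k ∈ pathIndices d i, j ≤ k →
        (pathBlockGraph d i v S c H).edist (v j) (v k) ≤ (d - 1 : ℕ) ∨ (v j = v 0 ∧ v k = v d) := by
      intro j hj k hk hjk
      by_cases hjk' : j = 0 ∧ k = d
      · rw [hjk'.1, hjk'.2]; exact Or.inr ⟨rfl, rfl⟩
      · refine Or.inl ((h.edist_path hj hk hjk).trans ?_)
        have := hle k hk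
        exact_mod_cast (by omega : k - j ≤ d - 1)
    rcases le_total j k with hjk | hjk
    · rcases key j hj k hk hjk with h1 | h1
      exacts [Or.inl h1, Or.inr (Or.inl h1)]
    · rcases key k hk j hj hjk with h1 | h1
      · rw [SimpleGraph.edist_comm]; exact Or.inl h1
      · exact Or.inr (Or.inr ⟨h1.2, h1.1⟩)

theorem ediam_eq : (pathBlockGraph d i v S c H).ediam = (d : ℕ∞) := by
  refine le_antisymm (SimpleGraph.ediam_le_of_edist_le fun x y => ?_) ?_
  · rcases h.edist_le_or x y with h1 | ⟨rfl, rfl⟩ | ⟨rfl, rfl⟩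
    · exact h1.trans (by exact_mod_cast Nat.sub_le d 1)
    · rw [h.edist_zero_last]
    · rw [SimpleGraph.edist_comm, h.edist_zero_last]
  · rw [← h.edist_zero_last]
    exact SimpleGraph.edist_le_ediam

theorem eq_ends {x y : V} (hxy : (pathBlockGraph d i v S c H).edist x y = (d : ℕ∞)) :
    (x = v 0 ∧ y = v d) ∨ (x = v d ∧ y = v 0) := by
  refine (h.edist_le_or x y).resolve_left fun h1 => ?_
  rw [hxy] at h1
  have h2 : d ≤ d - 1 := by exact_mod_cast h1
  have := h.add_two_le
  omega

/-- The graph and the first vertex determine the position of the block and the paths. -/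
theorem eq_of_eq {i' : ℕ} {v' : ℕ → V} {S' : Set V} {c' : ↥S' → Fin 3} {H' : SimpleGraph ↥S'}
    (h' : IsPathBlock d i' v' S' c' H')
    (hG : pathBlockGraph d i v S c H = pathBlockGraph d i' v' S' c' H') (h0 : v 0 = v' 0) :
    i = i' ∧ ∀ j ∈ pathIndices d i, v j = v' j := by
  have hl : ∀ x, blockLevel d i v S c x = blockLevel d i' v' S' c' x := by
    intro x
    have h1 := h.edist_zero x
    rw [hG, h0, h'.edist_zero] at h1
    exact_mod_cast h1.symm
  -- If i < i', level i would have two vertices in one description and only one in the other.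
  have hi : i = i' := by
    rcases lt_trichotomy i i' with hlt | heq | hlt
    · obtain ⟨x, y, hxy, hx, hy⟩ := h.exists_two_level
      have hmem : i ∈ pathIndices d i' := Or.inl hlt
      rw [hl] at hx hy
      exact absurd ((h'.eq_of_level_eq hmem hx).trans (h'.eq_of_level_eq hmem hy).symm) hxy
    · exact heq
    · obtain ⟨x, y, hxy, hx, hy⟩ := h'.exists_two_level
      have hmem : i' ∈ pathIndices d i := Or.inl hlt
      rw [← hl] at hx hy
      exact absurd ((h.eq_of_level_eq hmem hx).trans (h.eq_of_level_eq hmem hy).symm) hxy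
  subst hi
  refine ⟨rfl, fun j hj => h'.eq_of_level_eq hj ?_⟩
  rw [← hl, h.level_path hj]

/-- The graph and the paths determine the block. -/
theorem block_eq_of_eq {c' : ↥S → Fin 3} {H' : SimpleGraph ↥S} (h' : IsPathBlock d i v S c' H')
    (hG : pathBlockGraph d i v S c H = pathBlockGraph d i v S c' H') : c = c' ∧ H = H' := by
  constructor
  · ext1 ⟨x, hx⟩
    have h1 := h.adj_left hx
    have h2 := h.adj_right hx
    rw [hG, h'.adj_left hx] at h1
    rw [hG, h'.adj_right hx] at h2
    -- The two adjacencies tell whether the colour is 0 and whether it is 1, which determines an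
    -- element of `Fin 3`.
    generalize c ⟨x, hx⟩ = p at *
    generalize c' ⟨x, hx⟩ = q at *
    revert p q
    decide
  · ext ⟨x, hx⟩ ⟨y, hy⟩
    rw [← h.adj_mem hx hy, hG, h'.adj_mem hx hy]

theorem induce_mem_blockClass :
    (spineBlock S (v (i - 1)) (v (i + 2)) c H).comap Subtype.val ∈
      blockClass S (v (i - 1)) (v (i + 2)) := by
  set a := v (i - 1) with ha
  set b := v (i + 2) with hb
  set K := (spineBlock S a b c H).comap (Subtype.val : ↥(S ∪ {a, b}) → V) with hK
  obtain ⟨h1, h2, h3, h4⟩ := edist_le_of_mem_goodBlocks h.good (K := K)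
    (fun s => ⟨s.1, Or.inl s.2⟩) ⟨a, Or.inr (Or.inl rfl)⟩ ⟨b, Or.inr (Or.inr rfl)⟩
    (fun s t hst => (h.spineBlock_adj_mem s.2 t.2).2 hst)
    (fun s hs => (h.spineBlock_adj_left s.2).2 hs)
    (fun s hs => (h.spineBlock_adj_right s.2).2 hs)
  refine ⟨le_antisymm (h4 h.nonempty.to_subtype) ?_, ?_⟩
  -- The levels of the whole graph change by at most 1 along edges of the block and differ by 3
  -- between a and b, so the distance is at least 3.
  · have := le_add_edist_of_adj (G := K) (l := fun x => blockLevel d i v S c x.1)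
      (fun x y hxy => h.level_le_succ (le_sup_right (a := twoPaths d i v) hxy))
      ⟨a, Or.inr (Or.inl rfl)⟩ ⟨b, Or.inr (Or.inr rfl)⟩
    have hla : blockLevel d i v S c a = i - 1 := h.level_path h.left_mem
    have hlb : blockLevel d i v S c b = i + 2 := h.level_path h.right_mem
    rw [hla, hlb] at this
    have hi := h.one_le
    rw [show i + 2 = (i - 1) + 3 by omega, Nat.cast_add] at this
    exact (ENat.add_le_add_iff_left (ENat.natCast_ne_top _)).1 this
  · rintro ⟨x, hx⟩ ⟨y, hy⟩ hxy
    dsimp only at hxy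
    rcases hx with hx | rfl | rfl <;> rcases hy with hy | rfl | rfl
    · exact h1 ⟨x, hx⟩ ⟨y, hy⟩
    · rw [SimpleGraph.edist_comm]; exact h2 ⟨x, hx⟩
    · rw [SimpleGraph.edist_comm]; exact h3 ⟨x, hx⟩
    · exact h2 ⟨y, hy⟩
    · rw [SimpleGraph.edist_self]; exact zero_le
    · exact absurd rfl hxy
    · exact h3 ⟨y, hy⟩
    · exact absurd Sym2.eq_swap hxy
    · rw [SimpleGraph.edist_self]; exact zero_le

omit h in
theorem map_induce :
    ((spineBlock S (v (i - 1)) (v (i + 2)) c H).comap Subtype.val).map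
      (Function.Embedding.subtype (· ∈ S ∪ {v (i - 1), v (i + 2)})) =
        spineBlock S (v (i - 1)) (v (i + 2)) c H := by
  have hmem : ∀ x y, (spineBlock S (v (i - 1)) (v (i + 2)) c H).Adj x y →
      x ∈ S ∪ {v (i - 1), v (i + 2)} := by
    intro x y hxy
    by_cases hx : x ∈ S
    · exact Or.inl hx
    · exact Or.inr (eq_left_or_right hx hxy)
  ext x y
  rw [SimpleGraph.map_adj]
  constructor
  · rintro ⟨x', y', hxy, rfl, rfl⟩
    exact hxy
  · intro hxy
    exact ⟨⟨x, hmem x y hxy⟩, ⟨y, hmem y x hxy.symm⟩, hxy, rfl, rfl⟩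

end IsPathBlock

theorem IsPathBlock.mem_blockPlusPath {n d i : ℕ} {v : ℕ → Fin n} {S : Set (Fin n)}
    {c : ↥S → Fin 3} {H : SimpleGraph ↥S} (h : IsPathBlock d i v S c H) :
    pathBlockGraph d i v S c H ∈ blockPlusPath n d := by
  refine ⟨i, v, S, h.one_le, h.add_two_le, h.injOn, h.eq_compl, _, h.induce_mem_blockClass, ?_⟩
  rw [pathBlockGraph]
  congr 1
  exact IsPathBlock.map_induce.symm

end block

/-! ### Counting the constructed graphs -/

/-- `pathIndices` as a finite set. -/
def pathFinset (d i : ℕ) : Finset ℕ :=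
  range i ∪ Icc (i + 2) d

theorem mem_pathFinset {d i j : ℕ} : j ∈ pathFinset d i ↔ j ∈ pathIndices d i := by
  rw [pathFinset, mem_union, mem_range, mem_Icc]
  exact Iff.rfl

theorem card_pathFinset {d i : ℕ} (hid : i + 2 ≤ d) : #(pathFinset d i) = d - 1 := by
  rw [pathFinset, card_union_of_disjoint, card_range, Nat.card_Icc]
  · omega
  · rw [disjoint_left]
    intro j hj hj'
    have := mem_range.1 hj
    have := mem_Icc.1 hj'
    omega

section data

variable {n d i : ℕ}

/-- The sequence of the vertices of the two paths. -/
noncomputable def pathMap (u : Fin n) (f : ↥(pathFinset d i) ↪ Fin n) : ℕ → Fin n :=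
  Function.extend Subtype.val f fun _ => u

theorem pathMap_apply (u : Fin n) (f : ↥(pathFinset d i) ↪ Fin n) {j : ℕ}
    (hj : j ∈ pathFinset d i) : pathMap u f j = f ⟨j, hj⟩ :=
  Subtype.val_injective.extend_apply f (fun _ => u) ⟨j, hj⟩

theorem isPathBlock_pathMap (u : Fin n) (hi : 1 ≤ i) (hid : i + 2 ≤ d) (hdn : d ≤ n)
    (f : ↥(pathFinset d i) ↪ Fin n) {p : (↥(Set.range f)ᶜ → Fin 3) × SimpleGraph ↥(Set.range f)ᶜ}
    (hp : p ∈ goodBlocks ↥(Set.range f)ᶜ) :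
    IsPathBlock d i (pathMap u f) (Set.range f)ᶜ p.1 p.2 where
  one_le := hi
  add_two_le := hid
  injOn := by
    intro j hj k hk h
    rw [pathMap_apply u f (mem_pathFinset.2 hj), pathMap_apply u f (mem_pathFinset.2 hk)] at h
    exact congrArg Subtype.val (f.injective h)
  eq_compl := by
    congr 1
    ext x
    constructor
    · rintro ⟨⟨j, hj⟩, rfl⟩
      exact ⟨j, mem_pathFinset.1 hj, pathMap_apply u f hj⟩
    · rintro ⟨j, hj, rfl⟩
      exact ⟨⟨j, mem_pathFinset.2 hj⟩, (pathMap_apply u f _).symm⟩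
  nonempty := by
    rw [Set.nonempty_compl]
    intro h
    have h1 := Fintype.card_le_of_surjective f (Set.range_eq_univ.1 h)
    rw [Fintype.card_fin, Fintype.card_coe, card_pathFinset hid] at h1
    omega
  good := hp

/-- The positions of the block, the paths and the good blocks. -/
abbrev PathBlockData (n d : ℕ) : Type :=
  (i : ↥(Icc 1 (d - 2))) × (f : ↥(pathFinset d i) ↪ Fin n) × ↥(goodBlocks ↥(Set.range f)ᶜ)

/-- The graph that belongs to an element of `PathBlockData`. -/
noncomputable def PathBlockData.graph (u : Fin n) (x : PathBlockData n d) : SimpleGraph (Fin n) :=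
  pathBlockGraph d x.1 (pathMap u x.2.1) (Set.range x.2.1)ᶜ x.2.2.1.1 x.2.2.1.2

theorem PathBlockData.isPathBlock (u : Fin n) (hd : 3 ≤ d) (hdn : d ≤ n) (x : PathBlockData n d) :
    IsPathBlock d x.1 (pathMap u x.2.1) (Set.range x.2.1)ᶜ x.2.2.1.1 x.2.2.1.2 := by
  have := mem_Icc.1 x.1.2
  exact isPathBlock_pathMap u this.1 (by omega) hdn x.2.1 x.2.2.2

theorem PathBlockData.eq_of_graph_eq (u : Fin n) (hd : 3 ≤ d) (hdn : d ≤ n)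
    {x y : PathBlockData n d} (hxy : x.graph u = y.graph u)
    (h0 : pathMap u x.2.1 0 = pathMap u y.2.1 0) : x = y := by
  have hx := x.isPathBlock u hd hdn
  have hy := y.isPathBlock u hd hdn
  obtain ⟨hi, hv⟩ := hx.eq_of_eq hy hxy h0
  obtain ⟨⟨i, hi₁⟩, f, p, hp⟩ := x
  obtain ⟨⟨i', hi₂⟩, f', p', hp'⟩ := y
  obtain rfl : i = i' := hi
  obtain rfl : f = f' := by
    ext1 ⟨j, hj⟩
    have := hv j (mem_pathFinset.1 hj)
    rwa [pathMap_apply u f hj, pathMap_apply u f' hj] at this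
  obtain ⟨h1, h2⟩ := hx.block_eq_of_eq hy hxy
  obtain rfl : p = p' := Prod.ext h1 h2
  rfl

/-- The ends of the long path are determined by the graph up to order. Recording which end carries
the smaller label fixes the order, so the pair of this bit and the graph determines the data. -/
theorem card_pathBlockData_le (hd : 3 ≤ d) (hdn : d ≤ n) :
    Nat.card (PathBlockData n d) ≤ 2 * (graphsOfDiam n d ∩ blockPlusPath n d).ncard := by
  -- Only a default value for `pathMap` outside the path indices.
  have u : Fin n := ⟨0, by omega⟩
  let F : PathBlockData n d → Bool × ↥(graphsOfDiam n d ∩ blockPlusPath n d) := fun x =>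
    (decide (pathMap u x.2.1 0 < pathMap u x.2.1 d),
      ⟨x.graph u, (x.isPathBlock u hd hdn).ediam_eq, (x.isPathBlock u hd hdn).mem_blockPlusPath⟩)
  have hF : Function.Injective F := by
    intro x y hxy
    have h1 : decide (pathMap u x.2.1 0 < pathMap u x.2.1 d) =
      decide (pathMap u y.2.1 0 < pathMap u y.2.1 d) := congrArg Prod.fst hxy
    have h2 : x.graph u = y.graph u := congrArg (fun q => q.2.1) hxy
    rw [decide_eq_decide] at h1
    have hx := x.isPathBlock u hd hdn
    have hy := y.isPathBlock u hd hdn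
    refine PathBlockData.eq_of_graph_eq u hd hdn h2 ?_
    have h3 : (x.graph u).edist (pathMap u y.2.1 0) (pathMap u y.2.1 d) = (d : ℕ∞) := by
      rw [h2]; exact hy.edist_zero_last
    rcases hx.eq_ends h3 with h4 | h4
    · exact h4.1.symm
    · rw [h4.1, h4.2] at h1
      have hne : pathMap u x.2.1 0 ≠ pathMap u x.2.1 d := fun h => by
        have := hx.injOn hx.zero_mem hx.last_mem h
        omega
      rcases lt_or_gt_of_ne hne with h | h
      · exact absurd (h1.1 h) h.not_gt
      · exact absurd (h1.2 h) (not_lt_of_gt h)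
  have := Nat.card_le_card_of_injective F hF
  rwa [Nat.card_prod, Nat.card_eq_fintype_card (α := Bool), Fintype.card_bool,
    Nat.card_coe_set_eq] at this

theorem le_card_pathBlockData {δ : ℝ} (hd : 3 ≤ d) (hdn : d < n)
    (hδ : ((n - d + 1 : ℕ) : ℝ) ^ 2 * (3 / 4) ^ (n - d + 1 - 2) +
      3 * (n - d + 1 : ℕ) * (5 / 6) ^ (n - d + 1 - 1) ≤ δ) :
    (1 - δ) * ((d - 2) * n.descFactorial (d - 1) * 3 ^ (n - d + 1) * 2 ^ (n - d + 1).choose 2) ≤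
      Nat.card (PathBlockData n d) := by
  set m := n - d + 1 with hm
  have hblock : ∀ (i : ↥(Icc 1 (d - 2))) (f : ↥(pathFinset d i) ↪ Fin n),
      (1 - δ) * (3 ^ m * 2 ^ m.choose 2) ≤ (Nat.card ↥(goodBlocks ↥(Set.range f)ᶜ) : ℝ) := by
    intro i f
    have hi := mem_Icc.1 i.2
    have : Fintype ↥(Set.range f)ᶜ := Fintype.ofFinite _
    have hcard : Fintype.card ↥(Set.range f)ᶜ = m := by
      rw [← Nat.card_eq_fintype_card, Nat.card_coe_set_eq, Set.ncard_compl,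
        Set.ncard_range_of_injective f.injective, Nat.card_eq_finsetCard,
        card_pathFinset (by omega), Nat.card_eq_fintype_card, Fintype.card_fin]
      omega
    have h1 := le_ncard_goodBlocks (S := ↥(Set.range f)ᶜ) (by omega)
    rw [hcard] at h1
    rw [Nat.card_coe_set_eq]
    refine le_trans ?_ h1
    gcongr
  have hpath : ∀ i : ↥(Icc 1 (d - 2)), n.descFactorial (d - 1) * ((1 - δ) * (3 ^ m *
      2 ^ m.choose 2)) ≤ (Nat.card ((f : ↥(pathFinset d i) ↪ Fin n) ×
        ↥(goodBlocks ↥(Set.range f)ᶜ)) : ℝ) := by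
    intro i
    have hi := mem_Icc.1 i.2
    rw [Nat.card_sigma, Nat.cast_sum]
    refine le_trans (le_of_eq ?_) (card_nsmul_le_sum _ _ _ fun f _ => hblock i f)
    rw [card_univ, Fintype.card_embedding_eq, Fintype.card_fin, Fintype.card_coe,
      card_pathFinset (by omega), nsmul_eq_mul]
  rw [Nat.card_sigma, Nat.cast_sum]
  refine le_trans (le_of_eq ?_) (card_nsmul_le_sum _ _ _ fun i _ => hpath i)
  rw [card_univ, Fintype.card_coe, Nat.card_Icc, nsmul_eq_mul,
    show d - 2 + 1 - 1 = d - 2 by omega, Nat.cast_sub (by omega)]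
  push_cast
  ring

end data

/-! ### Asymptotics and conclusion -/

theorem tendsto_bad_fraction : Filter.Tendsto (fun m : ℕ => (m : ℝ) ^ 2 * (3 / 4) ^ (m - 2) +
    3 * m * (5 / 6) ^ (m - 1)) Filter.atTop (nhds 0) := by
  have h1 := tendsto_pow_const_mul_const_pow_of_abs_lt_one 2
    (show |(3 / 4 : ℝ)| < 1 by rw [abs_of_pos] <;> norm_num)
  have h2 := tendsto_pow_const_mul_const_pow_of_abs_lt_one 1
    (show |(5 / 6 : ℝ)| < 1 by rw [abs_of_pos] <;> norm_num)
  have h3 := (h1.const_mul (16 / 9)).add (h2.const_mul (18 / 5))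
  rw [mul_zero, mul_zero, add_zero] at h3
  refine h3.congr' ?_
  filter_upwards [Filter.eventually_ge_atTop 2] with m hm
  obtain ⟨j, rfl⟩ := Nat.exists_eq_add_of_le' hm
  rw [Nat.add_sub_cancel, show j + 2 - 1 = j + 1 by omega]
  ring

/-- Choosing 2^B ≥ n^8 minimally and using log 2 > 1/2 gives B ≤ 16 log n + 1, so 100B ≤ 1700 log n
because log n ≥ 1. The constant 2000 leaves room. -/
theorem hundred_mul_clog_le {n d : ℕ} (hn : 8 ≤ n)
    (h : (d : ℝ) < (n : ℝ) - 2000 * Real.log n) : 100 * Nat.clog 2 (n ^ 8) ≤ n - d + 1 := by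
  have hn0 : (8 : ℝ) ≤ n := by exact_mod_cast hn
  have hlog : 1 ≤ Real.log n := by
    rw [Real.le_log_iff_exp_le (by linarith)]
    linarith [Real.exp_one_lt_d9]
  have hdn : d ≤ n := by
    have : (d : ℝ) ≤ n := by linarith
    exact_mod_cast this
  have hone : 1 < n ^ 8 := Nat.one_lt_pow (by norm_num) (by omega)
  set B := Nat.clog 2 (n ^ 8) with hB
  have hBpos : 0 < B := Nat.clog_pos (by norm_num) hone
  have h1 : 2 ^ (B - 1) < n ^ 8 := Nat.pow_pred_clog_lt_self (by norm_num) hone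
  have h2 : (2 : ℝ) ^ (B - 1) ≤ (n : ℝ) ^ 8 := by exact_mod_cast h1.le
  have h3 := Real.log_le_log (by positivity) h2
  rw [Real.log_pow, Real.log_pow, Nat.cast_sub hBpos] at h3
  push_cast at h3
  have h4 := Real.log_two_gt_d9
  have h5 : ((B : ℝ) - 1) * (1 / 2) ≤ 8 * Real.log n := by
    refine le_trans ?_ h3
    have : (1 : ℝ) ≤ B := by exact_mod_cast hBpos
    gcongr
    linarith
  have h6 : (100 * B : ℝ) ≤ ((n - d : ℕ) : ℝ) + 1 := by
    rw [Nat.cast_sub hdn]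
    linarith
  exact_mod_cast h6

theorem graphsOfDiam_subset {n d : ℕ} (hn : 0 < n) : graphsOfDiam n d ⊆ graphsOfDiamAtLeast n d := by
  intro G hG
  have hG : G.ediam = (d : ℕ∞) := hG
  have : Nonempty (Fin n) := ⟨⟨0, hn⟩⟩
  exact ⟨SimpleGraph.connected_of_ediam_ne_top (by rw [hG]; exact ENat.natCast_ne_top d), hG.ge⟩

theorem theorem1 :
    ∃ c₁ : ℝ, 0 < c₁ ∧ ∀ ε : ℝ, 0 < ε → ∃ N : ℕ, ∀ n d : ℕ, N ≤ n → 3 ≤ d →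
      (d : ℝ) < (n : ℝ) - c₁ * Real.log (n : ℝ) →
        ((graphsOfDiamAtLeast n d \ blockPlusPath n d).ncard : ℝ) ≤
            ε * ((graphsOfDiamAtLeast n d).ncard : ℝ) ∧
          |((graphsOfDiam n d).ncard : ℝ) -
              ((d : ℝ) - 2) / 2 * (n.descFactorial (d - 1) : ℝ) * (3 : ℝ) ^ (n - d + 1) *
                (2 : ℝ) ^ ((n - d + 1).choose 2)| ≤
            ε * (((d : ℝ) - 2) / 2 * (n.descFactorial (d - 1) : ℝ) * (3 : ℝ) ^ (n - d + 1) *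
                (2 : ℝ) ^ ((n - d + 1).choose 2)) := by
  refine ⟨2000, by norm_num, fun ε hε => ?_⟩
  set δ : ℝ := min ε 1 / 8 with hδdef
  have hδ : 0 < δ := by positivity
  have hδε : 8 * δ ≤ ε := by rw [hδdef]; linarith [min_le_left ε 1]
  have hδ1 : 8 * δ ≤ 1 := by rw [hδdef]; linarith [min_le_right ε 1]
  obtain ⟨M, hM⟩ := Filter.eventually_atTop.1 (tendsto_bad_fraction.eventually_le_const hδ)
  -- The bound 9/δ turns the relative error 9/n into at most δ. The bound 2^M ≤ n forces M ≤ B,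
  -- hence M ≤ n - d + 1, so the fraction of bad blocks is at most δ uniformly in d.
  refine ⟨max (max 8 ⌈9 / δ⌉₊) (2 ^ M), fun n d hn hd hdn => ?_⟩
  have hn8 : 8 ≤ n := (le_max_left 8 _).trans ((le_max_left _ _).trans hn)
  have hnδ : ⌈9 / δ⌉₊ ≤ n := (le_max_right 8 _).trans ((le_max_left _ _).trans hn)
  have hnM : 2 ^ M ≤ n := (le_max_right _ _).trans hn
  have hn0 : (8 : ℝ) ≤ n := by exact_mod_cast hn8
  have hB := hundred_mul_clog_le hn8 hdn
  have hB' : n ^ 8 ≤ 2 ^ Nat.clog 2 (n ^ 8) := Nat.le_pow_clog (by norm_num) _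
  set B := Nat.clog 2 (n ^ 8)
  have hMB : M ≤ B := by
    refine (Nat.pow_le_pow_iff_right (by norm_num : 1 < 2)).1 ?_
    exact hnM.trans ((Nat.le_self_pow (by norm_num) n).trans hB')
  have hlt : d < n := by
    have h1 : 0 < Real.log n := Real.log_pos (by linarith)
    have : (d : ℝ) < n := by linarith
    exact_mod_cast this
  have hupper := ncard_graphsOfDiamAtLeast_le hn8 hd hlt hB' hB
  have hlower := (le_card_pathBlockData (δ := δ) hd hlt (hM _ (by omega))).trans
    (Nat.cast_le.2 (card_pathBlockData_le hd hlt.le))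
  have h9 : (9 / n : ℝ) ≤ δ := by
    rw [div_le_iff₀ (by linarith), ← div_le_iff₀' hδ]
    exact (Nat.le_ceil _).trans (by exact_mod_cast hnδ)
  set T : ℝ := ((d : ℝ) - 2) / 2 * (n.descFactorial (d - 1) : ℝ) * (3 : ℝ) ^ (n - d + 1) *
    (2 : ℝ) ^ ((n - d + 1).choose 2) with hT
  have hT0 : 0 ≤ T := by
    have : (3 : ℝ) ≤ d := by exact_mod_cast hd
    have : 0 ≤ (d : ℝ) - 2 := by linarith
    positivity
  have hsub := graphsOfDiam_subset (d := d) (show 0 < n by omega)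
  have hle1 : ((graphsOfDiam n d ∩ blockPlusPath n d).ncard : ℝ) ≤ (graphsOfDiam n d).ncard := by
    exact_mod_cast Set.ncard_le_ncard Set.inter_subset_left (Set.toFinite _)
  have hle2 : ((graphsOfDiam n d).ncard : ℝ) ≤ (graphsOfDiamAtLeast n d).ncard := by
    exact_mod_cast Set.ncard_le_ncard hsub (Set.toFinite _)
  -- The exceptional graphs are disjoint from the constructed ones, so they number at most (1 + δ)T
  -- - (1 - δ)T = 2δT.
  have hle3 : ((graphsOfDiamAtLeast n d \ blockPlusPath n d).ncard : ℝ) +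
      (graphsOfDiam n d ∩ blockPlusPath n d).ncard ≤ (graphsOfDiamAtLeast n d).ncard := by
    have hdis : Disjoint (graphsOfDiamAtLeast n d \ blockPlusPath n d)
        (graphsOfDiam n d ∩ blockPlusPath n d) :=
      Set.disjoint_left.2 fun G h1 h2 => h1.2 h2.2
    have h1 := Set.ncard_union_eq hdis (Set.toFinite _) (Set.toFinite _)
    have h2 := Set.ncard_le_ncard (Set.union_subset Set.sdiff_subset
      (Set.inter_subset_left.trans hsub) : (graphsOfDiamAtLeast n d \ blockPlusPath n d) ∪
        (graphsOfDiam n d ∩ blockPlusPath n d) ⊆ graphsOfDiamAtLeast n d) (Set.toFinite _)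
    rw [h1] at h2
    exact_mod_cast h2
  have hlow : (1 - δ) * T ≤ ((graphsOfDiam n d ∩ blockPlusPath n d).ncard : ℝ) := by
    push_cast at hlower
    rw [hT]
    linarith
  have hup : ((graphsOfDiamAtLeast n d).ncard : ℝ) ≤ (1 + δ) * T :=
    hupper.trans (by gcongr)
  have hδT : 0 ≤ δ * T := by positivity
  have hεT : 8 * (δ * T) ≤ ε * T := by rw [← mul_assoc]; gcongr
  have hδT1 : 8 * (δ * T) ≤ T := by
    rw [← mul_assoc]; exact mul_le_of_le_one_left hT0 hδ1
  constructor
  · have h1 : T / 2 ≤ ((graphsOfDiamAtLeast n d).ncard : ℝ) := by linarith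
    calc ((graphsOfDiamAtLeast n d \ blockPlusPath n d).ncard : ℝ) ≤ 2 * (δ * T) := by linarith
      _ ≤ ε * (T / 2) := by linarith
      _ ≤ _ := by gcongr
  · rw [abs_le]
    constructor <;> linarith
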